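/- A Krull domain is an integral domain $A$ such that $A_{\mathfrak p}$ is a discrete valuation ring for every prime $\mathfrak p$ of height one, $A=\bigcap_{\mathrm{ht}\,\mathfrak p=1}A_{\mathfrak p}$ in the fraction field of $A$, and every nonzero element of $A$ lies in only finitely many height-one primes (fields are Krull domains). A scheme is locally Krull if it has an open covering by spectra of Krull domains. Let $Y$ be a quasi-compact locally Krull scheme. For an $\mathcal O_Y$-module $\mathcal M$ put $\mathcal M^*=\mathcal{H}om_{\mathcal O_Y}(\mathcal M,\mathcal O_Y)$. An $\mathcal O_Y$-module $\mathcal M$ is a lattice if it is quasi-coherent and, for every affine open $U=\operatorname{Spec}A$ of $Y$ with $A$ a domain, $\Gamma(U,\mathcal M)$ is a torsion-free $A$-module isomorphic to a submodule of a finitely generated $A$-module. It is reflexive if it is a lattice and the canonical map $\mathcal M\to\mathcal M^{**}$ is an isomorphism; it has rank one if $\mathcal M_\xi$ is a one-dimensional $\mathcal O_{Y,\xi}$-vector space for every point $\xi$ such that $\mathcal O_{Y,\xi}$ is a field. Let $\mathrm{Cl}(Y)$ be the set of isomorphism classes of rank-one reflexive $\mathcal O_Y$-modules. For an open subset $U\subseteq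 Y$ write $\operatorname{codim}_Y(Y\setminus U)=\inf_{z\in Y\setminus U}\dim\mathcal O_{Y,z}$ (so that $\operatorname{codim}_Y\emptyset=\infty$), and let $\mathrm{Pic}(U)$ be the group of isomorphism classes of invertible $\mathcal O_U$-modules. **Proposition.** Let $Y$ be a quasi-compact locally Krull scheme. For rank-one reflexive $\mathcal M,\mathcal N$ the sheaf $(\mathcal M\otimes_{\mathcal O_Y}\mathcal N)^{**}$ is again rank-one reflexive, and $\mathrm{Cl}(Y)$ is an abelian group under $$[\mathcal M]+[\mathcal N]=[(\mathcal M\otimes_{\mathcal O_Y}\mathcal N)^{**}].$$ There is an isomorphism of abelian groups $$\mathrm{Cl}(Y)\;\cong\;\varinjlim_{U}\mathrm{Pic}(U),$$ where the direct limit is taken over all open subsets $U\subseteq Y$ with $\operatorname{codim}_Y(Y\setminus U)\ge 2$, ordered by reverse inclusion, with the restriction maps $\mathrm{Pic}(U)\to\mathrm{Pic}(V)$, $V\subseteq U$, as transition maps. The isomorphism can be chosen canonically: for every rank-one reflexive $\mathcal M$ and every such $U$ with $\mathcal M|_U$ invertible, it sends $[\mathcal M]$ to the class of $\mathcal M|_U\in\mathrm{Pic}(U)$.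 -/

import Mathlib

open CategoryTheory AlgebraicGeometry TopologicalSpace Opposite

universe u

noncomputable section

/-! ### Krull domains, lattices -/

/-- Krull domains: a domain `A` such that `A_p` is a discrete valuation ring for every height one
prime `p`, `A` is the intersection of these `A_p` inside its fraction field, and every nonzero
element lies in only finitely many height one primes. (Fields are Krull domains.) -/
structure IsKrullDomain (A : Type u) [CommRing A] : Prop where
  isDomain : IsDomain A
  isDiscreteValuationRing : ∀ (p : Ideal A) [p.IsPrime], p.height = 1 →
    ∃ _ : IsDomain (Localization.AtPrime p), IsDiscreteValuationRing (Localization.AtPrime p)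
  eq_iInter : ∀ x : FractionRing A,
    (∀ p : Ideal A, p.IsPrime → p.height = 1 →
      ∃ a s : A, s ∉ p ∧ x * algebraMap A (FractionRing A) s = algebraMap A (FractionRing A) a) →
    ∃ a : A, algebraMap A (FractionRing A) a = x
  finite : ∀ a : A, a ≠ 0 → {p : Ideal A | p.IsPrime ∧ p.height = 1 ∧ a ∈ p}.Finite

/-- Lattices over a domain `A`: torsion-free modules isomorphic to a submodule of a finitely
generated module. -/
def IsModuleLattice (A : Type u) [CommRing A] (M : Type u) [AddCommGroup M] [Module A M] : Prop :=
  Module.IsTorsionFree A M ∧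
    ∃ N : ModuleCat.{u} A, Module.Finite A N ∧ ∃ f : M →ₗ[A] N, Function.Injective f

namespace AlgebraicGeometry.Scheme

/-- A scheme is locally Krull if it is covered by spectra of Krull domains. -/
def IsLocallyKrull (Y : Scheme.{u}) : Prop :=
  ∀ y : Y, ∃ U : Y.Opens, y ∈ U ∧ IsAffineOpen U ∧ IsKrullDomain Γ(Y, U)

end AlgebraicGeometry.Scheme

namespace AlgebraicGeometry.Scheme.Modules

variable {X Y : Scheme.{u}}

/-! ### The dual of an `𝒪_X`-module -/

/-- The stalk `M_x` as a module over the local ring `𝒪_{X,x}`. -/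
instance stalkModule (M : X.Modules) (x : X) : Module (X.presheaf.stalk x) (M.presheaf.stalk x) :=
  PresheafOfModules.instModuleCarrierStalkCommRingCatCarrierAbPresheafOpensCarrier
    (R := X.presheaf) M.val x

/-- Sections over `U` of the sheaf hom `M^* = ℋom(M, 𝒪_X)`: morphisms `M|_U ⟶ 𝒪_U`, given as
families of `𝒪_X(V)`-linear maps `M(V) → 𝒪_X(V)`, for `V ⊆ U`, compatible with restriction. -/
def dualSections (M : X.Modules) (U : X.Opens) :
    AddSubgroup (∀ V : {V : X.Opens // V ≤ U}, Γ(M, V.1) →ₗ[Γ(X, V.1)] Γ(X, V.1)) where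
  carrier := {f | ∀ (V W : {V : X.Opens // V ≤ U}) (h : W.1 ≤ V.1) (m : Γ(M, V.1)),
    f W (M.presheaf.map (homOfLE h).op m) = X.presheaf.map (homOfLE h).op (f V m)}
  add_mem' {f g} hf hg V W h m := by
    simp only [Pi.add_apply, LinearMap.add_apply, map_add]
    rw [hf V W h, hg V W h]
  zero_mem' V W h m := by simp
  neg_mem' {f} hf V W h m := by
    simp only [Pi.neg_apply, LinearMap.neg_apply, map_neg]
    rw [hf V W h]

lemma res_res (M : X.Modules) {U V W : X.Opens} (h : V ≤ U) (h' : W ≤ V) (m : Γ(M, U)) :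
    M.presheaf.map (homOfLE h').op (M.presheaf.map (homOfLE h).op m) =
      M.presheaf.map (homOfLE (h'.trans h)).op m := by
  rw [← ConcreteCategory.comp_apply, ← Functor.map_comp]; rfl

lemma resO_resO {U V W : X.Opens} (h : V ≤ U) (h' : W ≤ V) (m : Γ(X, U)) :
    X.presheaf.map (homOfLE h').op (X.presheaf.map (homOfLE h).op m) =
      X.presheaf.map (homOfLE (h'.trans h)).op m := by
  rw [← ConcreteCategory.comp_apply, ← Functor.map_comp]; rfl

instance dualSectionsModule (M : X.Modules) (U : X.Opens) : Module Γ(X, U) (dualSections M U) where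
  smul a f := ⟨fun V ↦ X.presheaf.map (homOfLE V.2).op a • f.1 V, fun V W h m ↦ by
    simp only [LinearMap.smul_apply, smul_eq_mul, map_mul, resO_resO]
    rw [f.2 V W h]⟩
  one_smul f := Subtype.ext <| funext fun V ↦ by
    change X.presheaf.map (homOfLE V.2).op 1 • f.1 V = _
    rw [map_one, one_smul]
  mul_smul a b f := Subtype.ext <| funext fun V ↦ by
    change X.presheaf.map (homOfLE V.2).op (a * b) • f.1 V =
      X.presheaf.map (homOfLE V.2).op a • X.presheaf.map (homOfLE V.2).op b • f.1 V
    rw [map_mul, mul_smul]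
  smul_zero a := Subtype.ext <| funext fun V ↦ by
    change X.presheaf.map (homOfLE V.2).op a • 0 = 0
    rw [smul_zero]
  smul_add a f g := Subtype.ext <| funext fun V ↦ by
    change X.presheaf.map (homOfLE V.2).op a • (f.1 V + g.1 V) =
      X.presheaf.map (homOfLE V.2).op a • f.1 V + X.presheaf.map (homOfLE V.2).op a • g.1 V
    rw [smul_add]
  add_smul a b f := Subtype.ext <| funext fun V ↦ by
    change X.presheaf.map (homOfLE V.2).op (a + b) • f.1 V =
      X.presheaf.map (homOfLE V.2).op a • f.1 V + X.presheaf.map (homOfLE V.2).op b • f.1 V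
    rw [map_add, add_smul]
  zero_smul f := Subtype.ext <| funext fun V ↦ by
    change X.presheaf.map (homOfLE V.2).op 0 • f.1 V = 0
    rw [map_zero, zero_smul]

/-- Restriction of sections of `M^*`. -/
def dualRes (M : X.Modules) {U V : X.Opens} (h : V ≤ U) :
    dualSections M U →+ dualSections M V where
  toFun f := ⟨fun W ↦ f.1 ⟨W.1, W.2.trans h⟩, fun V' W' h' m ↦
    f.2 ⟨V'.1, V'.2.trans h⟩ ⟨W'.1, W'.2.trans h⟩ h' m⟩
  map_zero' := rfl
  map_add' _ _ := rfl

/-- `M^*` as a presheaf of abelian groups. -/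
def dualPresheafAb (M : X.Modules) : X.Opensᵒᵖ ⥤ Ab.{u} where
  obj U := AddCommGrpCat.of (dualSections M U.unop)
  map i := AddCommGrpCat.ofHom (dualRes M i.unop.le)

instance (M : X.Modules) (U : X.Opensᵒᵖ) :
    Module (X.ringCatSheaf.obj.obj U) ((dualPresheafAb M).obj U) :=
  inferInstanceAs (Module Γ(X, U.unop) (dualSections M U.unop))

/-- `M^*` as a presheaf of modules. -/
def dualPresheaf (M : X.Modules) : X.PresheafOfModules :=
  PresheafOfModules.ofPresheaf (dualPresheafAb M) (fun U V i (r : Γ(X, U.unop)) f ↦ by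
    refine Subtype.ext <| funext fun W ↦ ?_
    change X.presheaf.map (homOfLE (W.2.trans i.unop.le)).op r • f.1 ⟨W.1, W.2.trans i.unop.le⟩ =
      X.presheaf.map (homOfLE W.2).op (X.presheaf.map i r) • f.1 ⟨W.1, W.2.trans i.unop.le⟩
    exact congrArg (· • _) (resO_resO i.unop.le W.2 r).symm)


lemma dualSections_glue (M : X.Modules) {ι : Type u} (U : ι → X.Opens)
    (s : ∀ i, dualSections M (U i))
    (hs : ∀ i j (W : X.Opens) (hi : W ≤ U i) (hj : W ≤ U j), (s i).1 ⟨W, hi⟩ = (s j).1 ⟨W, hj⟩) :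
    ∃! t : dualSections M (iSup U), ∀ i, dualRes M (le_iSup U i) t = s i := by
  have cov (V : {V : X.Opens // V ≤ iSup U}) : V.1 ≤ ⨆ i, V.1 ⊓ U i := by
    rw [← inf_iSup_eq]; exact le_inf le_rfl V.2
  have key (V : {V : X.Opens // V ≤ iSup U}) (m : Γ(M, V.1)) : ∃ a : Γ(X, V.1), ∀ i,
      X.presheaf.map (homOfLE (inf_le_left : V.1 ⊓ U i ≤ V.1)).op a =
        (s i).1 ⟨V.1 ⊓ U i, inf_le_right⟩ (M.presheaf.map (homOfLE inf_le_left).op m) := by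
    have compat : TopCat.Presheaf.IsCompatible X.presheaf (fun i ↦ V.1 ⊓ U i)
        (fun i ↦ (s i).1 ⟨V.1 ⊓ U i, inf_le_right⟩
          (M.presheaf.map (homOfLE inf_le_left).op m)) := by
      intro i j
      have h1 := (s i).2 ⟨V.1 ⊓ U i, inf_le_right⟩
        ⟨(V.1 ⊓ U i) ⊓ (V.1 ⊓ U j), inf_le_left.trans inf_le_right⟩ inf_le_left
        (M.presheaf.map (homOfLE inf_le_left).op m)
      have h2 := (s j).2 ⟨V.1 ⊓ U j, inf_le_right⟩
        ⟨(V.1 ⊓ U i) ⊓ (V.1 ⊓ U j), inf_le_right.trans inf_le_right⟩ inf_le_right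
        (M.presheaf.map (homOfLE inf_le_left).op m)
      rw [res_res] at h1 h2
      exact h1.symm.trans (Eq.trans (by rw [hs i j]) h2)
    obtain ⟨a, ha, -⟩ := X.sheaf.existsUnique_gluing' (fun i ↦ V.1 ⊓ U i) V.1
      (fun i ↦ homOfLE inf_le_left) (cov V) _ compat
    exact ⟨a, ha⟩
  have ext (V : {V : X.Opens // V ≤ iSup U}) (a b : Γ(X, V.1))
      (h : ∀ i, X.presheaf.map (homOfLE (inf_le_left : V.1 ⊓ U i ≤ V.1)).op a =
        X.presheaf.map (homOfLE (inf_le_left : V.1 ⊓ U i ≤ V.1)).op b) : a = b :=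
    X.sheaf.eq_of_locally_eq' (fun i ↦ V.1 ⊓ U i) V.1 (fun i ↦ homOfLE inf_le_left) (cov V) a b h
  choose g hg using key
  refine ⟨⟨fun V ↦ ⟨⟨g V, fun m n ↦ ext V _ _ fun i ↦ ?_⟩, fun a m ↦ ext V _ _ fun i ↦ ?_⟩,
    fun V W h m ↦ ext W _ _ fun i ↦ ?_⟩, fun i ↦ Subtype.ext <| funext fun V ↦ LinearMap.ext
      fun m ↦ ?_, fun t ht ↦ Subtype.ext <| funext fun V ↦ LinearMap.ext fun m ↦ ext V _ _
      fun i ↦ ?_⟩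
  · simp only [map_add, hg]
  · simp only [hg, RingHom.id_apply, smul_eq_mul, map_mul, map_smul]
    exact (LinearMap.map_smul ((s i).1 ⟨V.1 ⊓ U i, inf_le_right⟩) _ _)
  · change X.presheaf.map _ (g W _) = X.presheaf.map _ (X.presheaf.map _ (g V m))
    have e : X.presheaf.map (homOfLE (inf_le_left : W.1 ⊓ U i ≤ W.1)).op
        (X.presheaf.map (homOfLE h).op (g V m)) =
        X.presheaf.map (homOfLE (inf_le_inf_right (U i) h)).op
          (X.presheaf.map (homOfLE inf_le_left).op (g V m)) := by
      rw [resO_resO, resO_resO]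
    rw [e, hg, hg, ← (s i).2 ⟨V.1 ⊓ U i, inf_le_right⟩ ⟨W.1 ⊓ U i, inf_le_right⟩
      (inf_le_inf_right (U i) h), res_res, res_res]
  · change g ⟨V.1, _⟩ m = _
    refine ext ⟨V.1, V.2.trans (le_iSup U i)⟩ _ _ fun j ↦ ?_
    rw [hg, ← (s i).2 V ⟨V.1 ⊓ U j, inf_le_left.trans V.2⟩ inf_le_left,
      hs i j (V.1 ⊓ U j) (inf_le_left.trans V.2) inf_le_right]
  · change _ = X.presheaf.map _ (g V m)
    rw [hg, ← ht i]
    exact (t.2 V ⟨V.1 ⊓ U i, inf_le_left.trans V.2⟩ inf_le_left m).symm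

lemma dualPresheaf_isSheaf (M : X.Modules) : TopCat.Presheaf.IsSheaf (dualPresheaf M).presheaf := by
  refine (TopCat.Presheaf.isSheaf_iff_isSheaf_comp (CategoryTheory.forget AddCommGrpCat) _).2 ?_
  refine (TopCat.Presheaf.isSheaf_iff_isSheafUniqueGluing_types _).2 ?_
  intro ι U s hs
  refine dualSections_glue M U s fun i j W hi hj ↦ ?_
  have := congrArg (fun f : dualSections M (U i ⊓ U j) ↦ f.1 ⟨W, le_inf hi hj⟩) (hs i j)
  exact this

/-- The dual `M^* = ℋom(M, 𝒪_X)` of an `𝒪_X`-module. -/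
def dual (M : X.Modules) : X.Modules where
  val := dualPresheaf M
  isSheaf := dualPresheaf_isSheaf M


/-- Evaluation at a section `m` of `M`, as a section of `M^**`. -/
def evalDual (M : X.Modules) (U : X.Opens) (m : Γ(M, U)) : dualSections (dual M) U :=
  ⟨fun V ↦ 
    { toFun := fun f : dualSections M V.1 ↦ f.1 ⟨V.1, le_rfl⟩ (M.presheaf.map (homOfLE V.2).op m)
      map_add' _ _ := rfl
      map_smul' a f := by
        change X.presheaf.map (𝟙 _) a * f.1 ⟨V.1, le_rfl⟩ _ = a * f.1 ⟨V.1, le_rfl⟩ _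
        rw [CategoryTheory.Functor.map_id]; rfl },
   fun V W h f ↦ by
    have := f.2 ⟨V.1, le_rfl⟩ ⟨W.1, h⟩ h (M.presheaf.map (homOfLE V.2).op m)
    rw [res_res] at this
    exact this⟩


/-- The canonical map `M ⟶ M^**`. -/
def toBidual (M : X.Modules) : M ⟶ dual (dual M) :=
  ⟨PresheafOfModules.homMk
    { app U := AddCommGrpCat.ofHom (Y := (dualPresheafAb (dual M)).obj U)
        (AddMonoidHom.mk' (evalDual M U.unop) fun (m n : Γ(M, U.unop)) ↦ Subtype.ext <| funext fun V ↦
          LinearMap.ext fun f : dualSections M V.1 ↦ by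
            change f.1 ⟨V.1, le_rfl⟩ (M.presheaf.map (homOfLE V.2).op (m + n)) =
              f.1 ⟨V.1, le_rfl⟩ (M.presheaf.map (homOfLE V.2).op m) +
                f.1 ⟨V.1, le_rfl⟩ (M.presheaf.map (homOfLE V.2).op n)
            rw [map_add, map_add])
      naturality U V i := by
        ext m
        refine Subtype.ext <| funext fun W ↦ LinearMap.ext fun f : dualSections M W.1 ↦ ?_
        exact congrArg (f.1 ⟨W.1, le_rfl⟩) (res_res M i.unop.le W.2 m) }
    fun U a m ↦ Subtype.ext <| funext fun V ↦ LinearMap.ext fun f : dualSections M V.1 ↦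
      (congrArg (f.1 ⟨V.1, le_rfl⟩) (map_smul M (homOfLE V.2) a m)).trans
        ((f.1 ⟨V.1, le_rfl⟩).map_smul _ _)⟩

/-! ### Local generators and associated sheaves -/

lemma bijective_of_locally {A B : TopCat.Presheaf Ab.{u} X} (hA : A.IsSheaf) (hB : B.IsSheaf)
    (U : X.Opens) (α : ∀ W ≤ U, A.obj (op W) →+ B.obj (op W))
    (nat : ∀ W h W' (i : W' ≤ W) (a : A.obj (op W)),
      α W' (i.trans h) (A.map (homOfLE i).op a) = B.map (homOfLE i).op (α W h a))
    (inj : ∀ W h (a : A.obj (op W)), α W h a = 0 → ∀ x ∈ W, ∃ W', ∃ i : W' ≤ W, x ∈ W' ∧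
      A.map (homOfLE i).op a = 0)
    (surj : ∀ W (h : W ≤ U) (b : B.obj (op W)), ∀ x ∈ W, ∃ W', ∃ i : W' ≤ W, x ∈ W' ∧
      ∃ a, α W' (i.trans h) a = B.map (homOfLE i).op b) (W : X.Opens) (h : W ≤ U) :
    Function.Bijective (α W h) := by
  have hinj (W) (h : W ≤ U) : Function.Injective (α W h) := by
    rw [injective_iff_map_eq_zero]
    intro a ha
    choose W' i hx h0 using inj W h a ha
    refine TopCat.Sheaf.eq_of_locally_eq' (⟨A, hA⟩ : TopCat.Sheaf Ab X)
      (fun x : W ↦ W' x.1 x.2) W (fun x ↦ homOfLE (i x.1 x.2)) ?_ a 0 fun x ↦ ?_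
    · intro x hx'
      exact Opens.mem_iSup.2 ⟨⟨x, hx'⟩, hx x hx'⟩
    · rw [map_zero]; exact h0 _ _
  refine ⟨hinj W h, fun b ↦ ?_⟩
  choose W' i hx a ha using surj W h b
  have cov : W ≤ ⨆ x : W, W' x.1 x.2 := fun x hx' ↦ Opens.mem_iSup.2 ⟨⟨x, hx'⟩, hx x hx'⟩
  have compat : TopCat.Presheaf.IsCompatible A (fun x : W ↦ W' x.1 x.2) (fun x ↦ a x.1 x.2) := by
    intro x y
    refine hinj (W' x.1 x.2 ⊓ W' y.1 y.2) (inf_le_left.trans ((i _ _).trans h)) ?_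
    have e1 := nat (W' x.1 x.2) ((i _ _).trans h) (W' x.1 x.2 ⊓ W' y.1 y.2) inf_le_left (a x.1 x.2)
    have e2 := nat (W' y.1 y.2) ((i _ _).trans h) (W' x.1 x.2 ⊓ W' y.1 y.2) inf_le_right
      (a y.1 y.2)
    refine e1.trans (Eq.trans ?_ e2.symm)
    rw [ha, ha, ← ConcreteCategory.comp_apply, ← ConcreteCategory.comp_apply,
      ← Functor.map_comp, ← Functor.map_comp]
    rfl
  obtain ⟨s, hs, -⟩ := TopCat.Sheaf.existsUnique_gluing' (⟨A, hA⟩ : TopCat.Sheaf Ab X)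
      (fun x : W ↦ W' x.1 x.2) W (fun x ↦ homOfLE (i x.1 x.2)) cov _ compat
  refine ⟨s, TopCat.Sheaf.eq_of_locally_eq' (⟨B, hB⟩ : TopCat.Sheaf Ab X)
      (fun x : W ↦ W' x.1 x.2) W (fun x ↦ homOfLE (i x.1 x.2)) cov _ _ fun x ↦ ?_⟩
  refine (nat W h _ (i x.1 x.2) s).symm.trans (Eq.trans ?_ (ha x.1 x.2))
  exact congrArg (α _ _) (hs x)

/-- `g ∈ P(V)` is a generator of `P` over `V` if `𝒪_V ⟶ P|_V`, `a ↦ a g`, is an isomorphism, i.e.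
if `a ↦ a • g|_W` is a bijection `𝒪_X(W) → P(W)` for all open `W ⊆ V`. -/
def IsGen (P : X.PresheafOfModules) (V : X.Opens) (g : P.obj (op V)) : Prop :=
  ∀ (W : X.Opens) (h : W ≤ V), Function.Bijective
    fun a : X.ringCatSheaf.obj.obj (op W) ↦ (a • P.map (homOfLE h).op g : P.obj (op W))

lemma pres_res (P : X.PresheafOfModules) {U V W : X.Opens} (h : V ≤ U) (h' : W ≤ V)
    (m : P.obj (op U)) :
    P.map (homOfLE h').op (P.map (homOfLE h).op m) = P.map (homOfLE (h'.trans h)).op m :=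
  (PresheafOfModules.map_comp_apply P (homOfLE h).op (homOfLE h').op m).symm

lemma IsGen.res {P : X.PresheafOfModules} {V : X.Opens} {g : P.obj (op V)} (hg : IsGen P V g)
    {W : X.Opens} (h : W ≤ V) : IsGen P W (P.map (homOfLE h).op g) := fun W' h' ↦ by
  have := hg W' (h'.trans h)
  rwa [← pres_res P h h'] at this

/-- The sheaf associated with a presheaf of modules. -/
def shf (P : X.PresheafOfModules) : X.Modules :=
  (PresheafOfModules.sheafification (𝟙 X.ringCatSheaf.obj)).obj P

/-- The canonical map to the associated sheaf. -/
def toShf (P : X.PresheafOfModules) : P ⟶ (shf P).val :=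
  PresheafOfModules.homMk (CategoryTheory.toSheafify (Opens.grothendieckTopology X) P.presheaf)
    fun U r m ↦ (((PresheafOfModules.sheafificationAdjunction (𝟙 X.ringCatSheaf.obj)).unit.app P).app
      U).hom.map_smul r m

/-- The universal property of the associated sheaf. -/
def shfLift {P : X.PresheafOfModules} {F : X.Modules} (ψ : P ⟶ F.val) : shf P ⟶ F :=
  ((PresheafOfModules.sheafificationAdjunction (𝟙 X.ringCatSheaf.obj)).homEquiv P F).symm
    (PresheafOfModules.homMk ((PresheafOfModules.toPresheaf _).map ψ)
      fun U r m ↦ (ψ.app U).hom.map_smul r m)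

lemma shfLift_app {P : X.PresheafOfModules} {F : X.Modules} (ψ : P ⟶ F.val) (U : X.Opens)
    (p : P.obj (op U)) : (shfLift ψ).val.app (op U) ((toShf P).app (op U) p) = ψ.app (op U) p := by
  have := ((PresheafOfModules.sheafificationAdjunction (𝟙 X.ringCatSheaf.obj)).homEquiv P
    F).apply_symm_apply (PresheafOfModules.homMk ((PresheafOfModules.toPresheaf _).map ψ)
      fun U r m ↦ (ψ.app U).hom.map_smul r m)
  exact congrArg (fun f ↦ (PresheafOfModules.Hom.app f (op U)).hom p)
    ((Adjunction.homEquiv_unit _ _ _ _).symm.trans this)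


lemma toShf_locInj {P : X.PresheafOfModules} {U : X.Opens} (p : P.obj (op U))
    (h : (toShf P).app (op U) p = 0) (x : X) (hx : x ∈ U) :
    ∃ W, ∃ i : W ≤ U, x ∈ W ∧ P.map (homOfLE i).op p = 0 := by
  have := CategoryTheory.Presheaf.equalizerSieve_mem (Opens.grothendieckTopology X)
    (CategoryTheory.toSheafify (Opens.grothendieckTopology X) P.presheaf) (X := op U) p
    (0 : P.obj (op U)) (h.trans (((toShf P).app (op U)).hom.map_zero).symm)
  obtain ⟨W, f, hf, hxW⟩ := this x hx
  exact ⟨W, f.le, hxW, Eq.trans hf ((P.map f.op).hom.map_zero)⟩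

lemma toShf_locSurj {P : X.PresheafOfModules} {U : X.Opens} (b : (shf P).val.obj (op U))
    (x : X) (hx : x ∈ U) : ∃ W, ∃ i : W ≤ U, x ∈ W ∧ ∃ p : P.obj (op W),
      (toShf P).app (op W) p = (shf P).val.map (homOfLE i).op b := by
  have := CategoryTheory.Presheaf.imageSieve_mem (Opens.grothendieckTopology X)
    (CategoryTheory.toSheafify (Opens.grothendieckTopology X) P.presheaf) (U := op U) b
  obtain ⟨W, f, ⟨p, hp⟩, hxW⟩ := this x hx
  exact ⟨W, f.le, hxW, p, hp⟩

lemma smul_res (P : X.PresheafOfModules) {V W : X.Opens} (h : W ≤ V)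
    (a : X.ringCatSheaf.obj.obj (op V)) (p : P.obj (op V)) :
    P.map (homOfLE h).op (a • p) =
      (X.ringCatSheaf.obj.map (homOfLE h).op a • P.map (homOfLE h).op p : P.obj (op W)) :=
  P.map_smul _ _ _

/-- The map `a ↦ a • g|_W`. -/
def smulHom (P : X.PresheafOfModules) {V : X.Opens} (g : P.obj (op V)) (W : X.Opens) (h : W ≤ V) :
    X.ringCatSheaf.obj.obj (op W) →+ P.obj (op W) :=
  AddMonoidHom.mk' (fun a ↦ a • P.map (homOfLE h).op g) fun a b ↦ add_smul a b _

lemma smulHom_res (P : X.PresheafOfModules) {V : X.Opens} (g : P.obj (op V)) (W : X.Opens)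
    (h : W ≤ V) (W' : X.Opens) (i : W' ≤ W) (a : X.ringCatSheaf.obj.obj (op W)) :
    smulHom P g W' (i.trans h) (X.ringCatSheaf.obj.map (homOfLE i).op a) =
      P.map (homOfLE i).op (smulHom P g W h a) := by
  refine Eq.trans ?_ (smul_res P i a (P.map (homOfLE h).op g)).symm
  rw [pres_res P h i]
  rfl

lemma toShf_gen {P : X.PresheafOfModules} {V : X.Opens} {g : P.obj (op V)} (hg : IsGen P V g) :
    IsGen (shf P).val V ((toShf P).app (op V) g) := by
  have key (W : X.Opens) (h : W ≤ V) (a : X.ringCatSheaf.obj.obj (op W)) :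
      smulHom (shf P).val ((toShf P).app (op V) g) W h a =
        (toShf P).app (op W) (smulHom P g W h a) := by
    refine Eq.trans ?_ (((toShf P).app (op W)).hom.map_smul a (P.map (homOfLE h).op g)).symm
    exact congrArg (a • ·) (PresheafOfModules.naturality_apply (toShf P) (homOfLE h).op g).symm
  refine bijective_of_locally
    (A := (SheafOfModules.unit X.ringCatSheaf).val.presheaf) (B := (shf P).val.presheaf)
    (SheafOfModules.unit X.ringCatSheaf).isSheaf (shf P).isSheaf V
    (smulHom (shf P).val ((toShf P).app (op V) g)) (smulHom_res _ _) ?_ ?_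
  · intro W h a ha x hx
    obtain ⟨W', i, hxW, h0⟩ := toShf_locInj _ ((key W h a).symm.trans ha) x hx
    refine ⟨W', i, hxW, (hg W' (i.trans h)).1 ?_⟩
    exact ((smulHom_res P g W h W' i a).trans h0).trans (smulHom P g W' (i.trans h)).map_zero.symm
  · intro W h b x hx
    obtain ⟨W', i, hxW, p, hp⟩ := toShf_locSurj b x hx
    obtain ⟨a, ha⟩ := (hg W' (i.trans h)).2 p
    exact ⟨W', i, hxW, a, (key W' _ a).trans ((congrArg _ ha).trans hp)⟩

lemma isIso_of_gen {A B : X.Modules} (φ : A ⟶ B) (h : ∀ x : X, ∃ V : X.Opens, x ∈ V ∧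
    ∃ g : A.val.obj (op V), IsGen A.val V g ∧ IsGen B.val V (φ.val.app (op V) g)) : IsIso φ := by
  rw [Hom.isIso_iff_isIso_app]
  intro U
  rw [ConcreteCategory.isIso_iff_bijective]
  have key (V W : X.Opens) (h : W ≤ V) (g : A.val.obj (op V)) (a : X.ringCatSheaf.obj.obj (op W)) :
      smulHom B.val (φ.val.app (op V) g) W h a = φ.val.app (op W) (smulHom A.val g W h a) := by
    refine Eq.trans ?_ ((φ.val.app (op W)).hom.map_smul a (A.val.map (homOfLE h).op g)).symm
    exact congrArg (a • ·) (PresheafOfModules.naturality_apply φ.val (homOfLE h).op g).symm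
  refine bijective_of_locally (A := A.val.presheaf) (B := B.val.presheaf) A.isSheaf B.isSheaf U
    (fun W _ ↦ (φ.app W).hom) (fun W _ W' i a ↦
      PresheafOfModules.naturality_apply φ.val (homOfLE i).op a) ?_ ?_ U le_rfl
  · intro W _ a ha x hx
    obtain ⟨V, hxV, g, hA, hB⟩ := h x
    refine ⟨W ⊓ V, inf_le_left, ⟨hx, hxV⟩, ?_⟩
    obtain ⟨c, hc⟩ := (hA (W ⊓ V) inf_le_right).2 (A.val.map (homOfLE inf_le_left).op a)
    have h1 : smulHom B.val (φ.val.app (op V) g) (W ⊓ V) inf_le_right c = 0 := by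
      refine (key V (W ⊓ V) inf_le_right g c).trans ?_
      refine (congrArg _ hc).trans ?_
      refine (PresheafOfModules.naturality_apply φ.val (homOfLE inf_le_left).op a).trans ?_
      exact (congrArg _ ha).trans ((B.val.map (homOfLE inf_le_left).op).hom.map_zero)
    have h2 : c = 0 := (hB (W ⊓ V) inf_le_right).1 (h1.trans (zero_smul _ _).symm)
    subst h2
    exact hc.symm.trans (zero_smul _ _)
  · intro W _ b x hx
    obtain ⟨V, hxV, g, hA, hB⟩ := h x
    refine ⟨W ⊓ V, inf_le_left, ⟨hx, hxV⟩, ?_⟩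
    obtain ⟨c, hc⟩ := (hB (W ⊓ V) inf_le_right).2 (B.val.map (homOfLE inf_le_left).op b)
    exact ⟨smulHom A.val g (W ⊓ V) inf_le_right c,
      (key V (W ⊓ V) inf_le_right g c).symm.trans hc⟩

lemma bijective_smul_tmul {R M N : Type*} [CommRing R] [AddCommGroup M] [AddCommGroup N]
    [Module R M] [Module R N] {m : M} {n : N} (hm : Function.Bijective fun a : R ↦ a • m)
    (hn : Function.Bijective fun a : R ↦ a • n) :
    Function.Bijective fun a : R ↦ a • (TensorProduct.tmul R m n) := by
  let e₁ : R ≃ₗ[R] M := LinearEquiv.ofBijective (LinearMap.toSpanSingleton R M m) hm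
  let e₂ : R ≃ₗ[R] N := LinearEquiv.ofBijective (LinearMap.toSpanSingleton R N n) hn
  have : (fun a : R ↦ a • (TensorProduct.tmul R m n)) =
      ((TensorProduct.lid R R).symm ≪≫ₗ TensorProduct.congr e₁ e₂) := by
    ext a
    change a • TensorProduct.tmul R m n = TensorProduct.tmul R ((1 : R) • m) (a • n)
    rw [one_smul, TensorProduct.tmul_smul]
  rw [this]
  exact LinearEquiv.bijective _

/-- The presheaf tensor product `U ↦ P(U) ⊗_{𝒪_X(U)} Q(U)`. -/
abbrev tensorP (P Q : X.PresheafOfModules) : X.PresheafOfModules :=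
  PresheafOfModules.Monoidal.tensorObj (R := X.presheaf) P Q

lemma gen_tensor {P Q : X.PresheafOfModules} {V : X.Opens} {p : P.obj (op V)} {q : Q.obj (op V)}
    (hp : IsGen P V p) (hq : IsGen Q V q) :
    IsGen (tensorP P Q) V (TensorProduct.tmul Γ(X, V) p q) := fun W h ↦
  letI : Module Γ(X, W) (P.obj (op W)) := (P.obj (op W)).isModule
  letI : Module Γ(X, W) (Q.obj (op W)) := (Q.obj (op W)).isModule
  bijective_smul_tmul (R := Γ(X, W)) (M := P.obj (op W)) (N := Q.obj (op W)) (hp W h) (hq W h)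

lemma isGen_one (V : X.Opens) : IsGen (PresheafOfModules.unit X.ringCatSheaf.obj) V
    (1 : X.ringCatSheaf.obj.obj (op V)) := fun W h ↦ by
  have : (fun a : X.ringCatSheaf.obj.obj (op W) ↦
      (a • (PresheafOfModules.unit X.ringCatSheaf.obj).map (homOfLE h).op
      (1 : X.ringCatSheaf.obj.obj (op V)) : X.ringCatSheaf.obj.obj (op W))) = id := by
    funext a
    refine Eq.trans (congrArg (a * ·) (X.ringCatSheaf.obj.map (homOfLE h).op).hom.map_one) ?_
    exact mul_one a
  exact this ▸ Function.bijective_id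

/-! ### Tensor products and invertible sheaves -/

/-- The tensor product `M ⊗_{𝒪_X} N` of `𝒪_X`-modules. -/
def tensor (M N : X.Modules) : X.Modules := shf (tensorP M.val N.val)

/-- Invertible sheaves: `𝒪_X`-modules that are locally free of rank one, i.e. every point has an
open neighbourhood `V` with a section `g` such that `𝒪_V ⟶ L|_V`, `a ↦ a g`, is an isomorphism. -/
def IsInvertible (L : X.Modules) : Prop :=
  ∀ x : X, ∃ V : X.Opens, x ∈ V ∧ ∃ g : L.val.obj (op V), IsGen L.val V g

/-- Associated sheaves of isomorphic presheaves. -/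
def shfIso {P Q : X.PresheafOfModules} (e : P ≅ Q) : shf P ≅ shf Q :=
  Functor.mapIso (PresheafOfModules.sheafification (𝟙 X.ringCatSheaf.obj)) e

lemma isIso_shfLift {P : X.PresheafOfModules} {F : X.Modules} (ψ : P ⟶ F.val)
    (h : ∀ x : X, ∃ V : X.Opens, x ∈ V ∧
      ∃ g : P.obj (op V), IsGen P V g ∧ IsGen F.val V (ψ.app (op V) g)) : IsIso (shfLift ψ) := by
  refine isIso_of_gen _ fun x ↦ ?_
  obtain ⟨V, hV, g, hg, hg'⟩ := h x
  exact ⟨V, hV, _, toShf_gen hg, Eq.mpr (congrArg (IsGen F.val V) (shfLift_app ψ V g)) hg'⟩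

/-- Presheaves of `𝒪_X`-modules, with Mathlib's symmetric monoidal structure. -/
abbrev PM (X : Scheme.{u}) :=
  _root_.PresheafOfModules.{u} (X.presheaf ⋙ forget₂ CommRingCat RingCat)

/-- The isomorphism of presheaves underlying an isomorphism of sheaves. -/
def valIso {M N : X.Modules} (e : M ≅ N) : (show PM X from M.val) ≅ (show PM X from N.val) :=
  (toPresheafOfModules X).mapIso e

/-- The tensor product respects isomorphisms. -/
def tensorCongr {M M' N N' : X.Modules} (e : M ≅ M') (e' : N ≅ N') : tensor M N ≅ tensor M' N' :=
  shfIso (MonoidalCategory.tensorIso (C := PM X) (valIso e) (valIso e'))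

/-- Commutativity of the tensor product. -/
def tensorComm (M N : X.Modules) : tensor M N ≅ tensor N M :=
  shfIso (BraidedCategory.braiding (C := PM X) M.val N.val)

/-- The structure sheaf as an `𝒪_X`-module. -/
def unitM (X : Scheme.{u}) : X.Modules := SheafOfModules.unit X.ringCatSheaf

lemma isInvertible_unit : IsInvertible (unitM X) := fun _ ↦ ⟨⊤, trivial, _, isGen_one ⊤⟩

lemma IsInvertible.tensor {L M : X.Modules} (hL : IsInvertible L) (hM : IsInvertible M) :
    IsInvertible (tensor L M) := fun x ↦ by
  obtain ⟨V, hV, g, hg⟩ := hL x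
  obtain ⟨W, hW, g', hg'⟩ := hM x
  exact ⟨V ⊓ W, ⟨hV, hW⟩, _, toShf_gen (gen_tensor (hg.res inf_le_left) (hg'.res inf_le_right))⟩

lemma gens {L M N : X.Modules} (hL : IsInvertible L) (hM : IsInvertible M)
    (hN : IsInvertible N) (x : X) : ∃ V : X.Opens, x ∈ V ∧
      ∃ l : L.val.obj (op V), IsGen L.val V l ∧ ∃ m : M.val.obj (op V), IsGen M.val V m ∧
      ∃ n : N.val.obj (op V), IsGen N.val V n := by
  obtain ⟨U, hU, l, hl⟩ := hL x
  obtain ⟨V, hV, m, hm⟩ := hM x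
  obtain ⟨W, hW, n, hn⟩ := hN x
  exact ⟨U ⊓ (V ⊓ W), ⟨hU, hV, hW⟩, _, hl.res inf_le_left, _,
    hm.res (inf_le_right.trans inf_le_left), _, hn.res (inf_le_right.trans inf_le_right)⟩

lemma unitTensor {L : X.Modules} (hL : IsInvertible L) : Nonempty (tensor (unitM X) L ≅ L) := by
  have : IsIso (shfLift (F := L) (MonoidalCategory.leftUnitor (C := PM X) L.val).hom) := by
    refine isIso_shfLift _ fun x ↦ ?_
    obtain ⟨V, hV, l, hl⟩ := hL x
    refine ⟨V, hV, _, gen_tensor (isGen_one V) hl, ?_⟩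
    exact Eq.mpr (congrArg (IsGen L.val V) (one_smul (X.ringCatSheaf.obj.obj (op V)) l)) hl
  exact ⟨@asIso X.Modules _ _ _ _ this⟩

lemma IsGen.exists_dual {L : X.Modules} {V : X.Opens} {g : Γ(L, V)} (hg : IsGen L.val V g) :
    ∃ g' : dualSections L V, IsGen (dual L).val V g' ∧ g'.1 ⟨V, le_rfl⟩ g = 1 := by
  let e (W : X.Opens) (h : W ≤ V) : Γ(X, W) ≃ₗ[Γ(X, W)] Γ(L, W) :=
    LinearEquiv.ofBijective (LinearMap.toSpanSingleton Γ(X, W) Γ(L, W)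
      (L.presheaf.map (homOfLE h).op g)) (hg W h)
  have e_apply (W : X.Opens) (h : W ≤ V) (a : Γ(X, W)) :
      e W h a = a • L.presheaf.map (homOfLE h).op g := rfl
  let g' : dualSections L V := ⟨fun W ↦ (e W.1 W.2).symm, fun W W' h m ↦ by
    obtain ⟨a, rfl⟩ := (e W.1 W.2).surjective m
    change (e W'.1 W'.2).symm _ = X.presheaf.map (homOfLE h).op ((e W.1 W.2).symm _)
    rw [LinearEquiv.symm_apply_apply, LinearEquiv.symm_apply_eq, e_apply, e_apply, map_smul,
      res_res]⟩
  have hg' (W : X.Opens) (h : W ≤ V) : g'.1 ⟨W, h⟩ (L.presheaf.map (homOfLE h).op g) = 1 := by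
    change (e W h).symm _ = 1
    rw [LinearEquiv.symm_apply_eq, e_apply, one_smul]
  refine ⟨g', fun W h ↦ ?_, ?_⟩
  · refine Function.bijective_iff_has_inverse.2
      ⟨fun f : dualSections L W ↦ f.1 ⟨W, le_rfl⟩ (L.presheaf.map (homOfLE h).op g), fun a ↦ ?_,
        fun f ↦ Subtype.ext <| funext fun W' ↦ LinearMap.ext fun m ↦ ?_⟩
    · change X.presheaf.map (𝟙 _) a * g'.1 ⟨W, _⟩ _ = a
      rw [hg', CategoryTheory.Functor.map_id]
      exact mul_one _
    · obtain ⟨a, rfl⟩ := (e W'.1 (W'.2.trans h)).surjective m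
      change X.presheaf.map (homOfLE W'.2).op (f.1 ⟨W, le_rfl⟩ (L.presheaf.map (homOfLE h).op g)) *
        (e W'.1 (W'.2.trans h)).symm _ = _
      rw [LinearEquiv.symm_apply_apply, ← f.2 ⟨W, le_rfl⟩ W' W'.2, e_apply, res_res,
        LinearMap.map_smul, smul_eq_mul, mul_comm]
  · have := hg' V le_rfl
    rwa [show (homOfLE (le_refl V)).op = 𝟙 (op V) from rfl, CategoryTheory.Functor.map_id] at this

lemma IsInvertible.dual {L : X.Modules} (hL : IsInvertible L) : IsInvertible (dual L) := fun x ↦ by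
  obtain ⟨V, hV, g, hg⟩ := hL x
  obtain ⟨g', hg', -⟩ := hg.exists_dual
  exact ⟨V, hV, g', hg'⟩

/-- The evaluation map `L^* ⊗ L ⟶ 𝒪_X` on the presheaf tensor product. -/
def evP (L : X.Modules) : tensorP (Modules.dual L).val L.val ⟶ (unitM X).val where
  app U := ModuleCat.MonoidalCategory.tensorLift (R := Γ(X, U.unop))
    (M₁ := (Modules.dual L).val.obj U) (M₂ := L.val.obj U) (M₃ := ModuleCat.of Γ(X, U.unop) Γ(X, U.unop))
    (fun (f : dualSections L U.unop) (m : Γ(L, U.unop)) ↦ f.1 ⟨U.unop, le_rfl⟩ m)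
    (fun _ _ _ ↦ rfl)
    (fun a (f : dualSections L U.unop) m ↦ by
      change X.presheaf.map (𝟙 _) a * f.1 ⟨U.unop, le_rfl⟩ m = a * f.1 ⟨U.unop, le_rfl⟩ m
      rw [CategoryTheory.Functor.map_id]; rfl)
    (fun (f : dualSections L U.unop) m n ↦ (f.1 ⟨U.unop, le_rfl⟩).map_add m n)
    (fun a (f : dualSections L U.unop) m ↦ (f.1 ⟨U.unop, le_rfl⟩).map_smul a m)
  naturality {U V} i := by
    refine ModuleCat.MonoidalCategory.tensor_ext (R := Γ(X, U.unop))
      (M₁ := (Modules.dual L).val.obj U) (M₂ := L.val.obj U) fun (f : dualSections L U.unop) m ↦ ?_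
    exact f.2 ⟨U.unop, le_rfl⟩ ⟨V.unop, i.unop.le⟩ i.unop.le m

lemma dualTensor {L : X.Modules} (hL : IsInvertible L) :
    Nonempty (Modules.tensor (Modules.dual L) L ≅ unitM X) := by
  have : IsIso (shfLift (evP L)) := by
    refine isIso_shfLift _ fun x ↦ ?_
    obtain ⟨V, hV, g, hg⟩ := hL x
    obtain ⟨g', hg', h1⟩ := hg.exists_dual
    refine ⟨V, hV, _, gen_tensor (P := (Modules.dual L).val) (p := g') hg' hg, ?_⟩
    exact Eq.mpr (congrArg (IsGen (unitM X).val V) h1) (isGen_one V)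
  exact ⟨@asIso X.Modules _ _ _ _ this⟩

lemma tensorAssoc {L M N : X.Modules} (hL : IsInvertible L) (hM : IsInvertible M)
    (hN : IsInvertible N) : Nonempty (tensor (tensor L M) N ≅ tensor L (tensor M N)) := by
  let f₁ : tensorP (tensorP L.val M.val) N.val ⟶ tensorP (tensor L M).val N.val :=
    PresheafOfModules.Monoidal.tensorHom (R := X.presheaf) (toShf (tensorP L.val M.val)) (𝟙 _)
  let f₂ : tensorP L.val (tensorP M.val N.val) ⟶ tensorP L.val (tensor M N).val :=
    PresheafOfModules.Monoidal.tensorHom (R := X.presheaf) (𝟙 _) (toShf (tensorP M.val N.val))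
  have h₁ : IsIso (shfLift (F := tensor (tensor L M) N) (f₁ ≫ toShf _)) := by
    refine isIso_shfLift _ fun x ↦ ?_
    obtain ⟨V, hV, l, hl, m, hm, n, hn⟩ := gens hL hM hN x
    exact ⟨V, hV, _, gen_tensor (gen_tensor hl hm) hn,
      toShf_gen (gen_tensor (toShf_gen (gen_tensor hl hm)) hn)⟩
  have h₂ : IsIso (shfLift (F := tensor L (tensor M N)) (f₂ ≫ toShf _)) := by
    refine isIso_shfLift _ fun x ↦ ?_
    obtain ⟨V, hV, l, hl, m, hm, n, hn⟩ := gens hL hM hN x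
    exact ⟨V, hV, _, gen_tensor hl (gen_tensor hm hn),
      toShf_gen (gen_tensor hl (toShf_gen (gen_tensor hm hn)))⟩
  exact ⟨(asIso (shfLift (F := tensor (tensor L M) N) (f₁ ≫ toShf _))).symm ≪≫ shfIso (MonoidalCategory.associator (C := PM X) L.val M.val N.val) ≪≫
    asIso (shfLift (F := tensor L (tensor M N)) (f₂ ≫ toShf _))⟩

/-! ### Restriction to open subschemes -/
section
variable (f : X ⟶ Y) [IsOpenImmersion f]

lemma IsGen.restrict {L : Y.Modules} {V : Y.Opens} {g : L.val.obj (op V)} (hg : IsGen L.val V g)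
    {W : X.Opens} (h : f ''ᵁ W ≤ V) :
    IsGen (L.restrict f).val W (L.val.map (homOfLE h).op g) := fun W' h' ↦ by
  have h1 := (hg (f ''ᵁ W') ((f.image_mono h').trans h)).comp
    (ConcreteCategory.bijective_of_isIso (f.appIso W').inv)
  have h2 := pres_res L.val h (f.image_mono h') g
  rw [← h2] at h1
  exact h1

lemma IsInvertible.restrict {L : Y.Modules} (hL : IsInvertible L) : IsInvertible (L.restrict f) :=
  fun x ↦ by
    obtain ⟨V, hV, g, hg⟩ := hL (f x)
    exact ⟨f ⁻¹ᵁ V, hV, _, hg.restrict f (f.image_preimage_le V)⟩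

/-- The section `l ⊗ m` of `L ⊗ M`. -/
def tmul {L M : X.Modules} {U : X.Opens} (l : Γ(L, U)) (m : Γ(M, U)) : Γ(tensor L M, U) :=
  (toShf (tensorP L.val M.val)).app (op U) (TensorProduct.tmul Γ(X, U) l m)

section
variable {L M : X.Modules} {U : X.Opens}

lemma add_tmul (l l' : Γ(L, U)) (m : Γ(M, U)) : tmul (l + l') m = tmul l m + tmul l' m :=
  (congrArg ((toShf (tensorP L.val M.val)).app (op U)) (TensorProduct.add_tmul (R := Γ(X, U)) l l' m)).trans
    (((toShf (tensorP L.val M.val)).app (op U)).hom.map_add _ _)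

lemma tmul_add (l : Γ(L, U)) (m m' : Γ(M, U)) : tmul l (m + m') = tmul l m + tmul l m' :=
  (congrArg ((toShf (tensorP L.val M.val)).app (op U)) (TensorProduct.tmul_add (R := Γ(X, U)) l m m')).trans
    (((toShf (tensorP L.val M.val)).app (op U)).hom.map_add _ _)

lemma smul_tmul (a : Γ(X, U)) (l : Γ(L, U)) (m : Γ(M, U)) : tmul (a • l) m = a • tmul l m :=
  ((toShf (tensorP L.val M.val)).app (op U)).hom.map_smul a (TensorProduct.tmul Γ(X, U) l m)

lemma tmul_smul (a : Γ(X, U)) (l : Γ(L, U)) (m : Γ(M, U)) : tmul l (a • m) = a • tmul l m :=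
  (congrArg ((toShf (tensorP L.val M.val)).app (op U)) (TensorProduct.tmul_smul (R := Γ(X, U)) a l m)).trans
    (((toShf (tensorP L.val M.val)).app (op U)).hom.map_smul a (TensorProduct.tmul Γ(X, U) l m))

end

/-- The canonical map from the presheaf tensor product of restrictions to the restriction of the
tensor product. -/
def resTensorP (L M : Y.Modules) :
    tensorP (L.restrict f).val (M.restrict f).val ⟶ ((tensor L M).restrict f).val where
  app U := ModuleCat.MonoidalCategory.tensorLift (R := Γ(X, U.unop))
    (M₁ := (L.restrict f).val.obj U) (M₂ := (M.restrict f).val.obj U)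
    (M₃ := ((tensor L M).restrict f).val.obj U)
    (fun (l : Γ(L, f ''ᵁ U.unop)) (m : Γ(M, f ''ᵁ U.unop)) ↦ tmul l m)
    (fun l l' m ↦ add_tmul (L := L) (M := M) l l' m)
    (fun a l m ↦ smul_tmul (L := L) (M := M) ((f.appIso U.unop).inv a) l m)
    (fun l m m' ↦ tmul_add (L := L) (M := M) l m m')
    (fun a l m ↦ tmul_smul (L := L) (M := M) ((f.appIso U.unop).inv a) l m)
  naturality {U V} i := by
    refine ModuleCat.MonoidalCategory.tensor_ext (R := Γ(X, U.unop))
      (M₁ := (L.restrict f).val.obj U) (M₂ := (M.restrict f).val.obj U)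
      fun (l : L.val.obj (op (f ''ᵁ U.unop))) (m : M.val.obj (op (f ''ᵁ U.unop))) ↦ ?_
    exact PresheafOfModules.naturality_apply (toShf (tensorP L.val M.val))
      (homOfLE (f.image_mono i.unop.le)).op (TensorProduct.tmul Γ(Y, f ''ᵁ U.unop) l m)

lemma restrictTensor {L M : Y.Modules} (hL : IsInvertible L) (hM : IsInvertible M) :
    Nonempty ((tensor L M).restrict f ≅ tensor (L.restrict f) (M.restrict f)) := by
  have : IsIso (shfLift (resTensorP f L M)) := by
    refine isIso_shfLift _ fun x ↦ ?_
    obtain ⟨V, hV, g, hg⟩ := hL (f x)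
    obtain ⟨W, hW, g', hg'⟩ := hM (f x)
    have h1 := f.image_preimage_le (V ⊓ W)
    refine ⟨f ⁻¹ᵁ (V ⊓ W), ⟨hV, hW⟩, _, gen_tensor (hg.restrict f (h1.trans inf_le_left))
      (hg'.restrict f (h1.trans inf_le_right)), ?_⟩
    have h2 := gen_tensor (hg.res (h1.trans inf_le_left)) (hg'.res (h1.trans inf_le_right))
    have h3 := (toShf_gen h2).restrict (L := tensor L M) f (W := f ⁻¹ᵁ (V ⊓ W)) le_rfl
    have h4 (N : Y.PresheafOfModules) (W : Y.Opens) (n : N.obj (op W)) :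
        N.map (homOfLE (le_refl W)).op n = n := by
      rw [show (homOfLE (le_refl W)).op = 𝟙 (op W) from rfl, N.map_id]
      rfl
    exact Eq.mp (congrArg (IsGen _ _) (h4 (tensor L M).val _ _)) h3
  exact ⟨(@asIso X.Modules _ _ _ _ this).symm⟩
lemma restrictUnit : Nonempty ((unitM Y).restrict f ≅ unitM X) := ⟨restrictUnitIso f⟩

end

/-! ### Lattices and reflexive sheaves -/

/-- An `𝒪_X`-module (on a locally integral scheme) is a lattice if it is quasi-coherent and its
sections over each affine open `U` with `𝒪_X(U)` a domain form an `𝒪_X(U)`-lattice. -/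
def IsLattice (M : X.Modules) : Prop :=
  SheafOfModules.IsQuasicoherent M ∧
    ∀ U : X.Opens, IsAffineOpen U → IsDomain Γ(X, U) → IsModuleLattice Γ(X, U) Γ(M, U)

/-- Reflexive `𝒪_X`-modules: lattices `M` such that the canonical map `M ⟶ M^**` is an
isomorphism. -/
def IsReflexive (M : X.Modules) : Prop := IsLattice M ∧ IsIso (toBidual M)

/-- `M` has rank one: `M_ξ` is one-dimensional whenever `𝒪_{X,ξ}` is a field. -/
def HasRankOne (M : X.Modules) : Prop :=
  ∀ ξ : X, IsField (X.presheaf.stalk ξ) →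
    Module.finrank (X.presheaf.stalk ξ) (M.presheaf.stalk ξ) = 1

/-- Rank-one reflexive sheaves. -/
def IsRankOneReflexive (M : X.Modules) : Prop := IsReflexive M ∧ HasRankOne M

end AlgebraicGeometry.Scheme.Modules

namespace AlgebraicGeometry.Scheme

open Modules

variable {X Y : Scheme.{u}}

/-! ### The class group -/

/-- Isomorphism of rank-one reflexive sheaves. -/
def clSetoid (Y : Scheme.{u}) : Setoid {M : Y.Modules // IsRankOneReflexive M} where
  r M N := Nonempty (M.1 ≅ N.1)
  iseqv := ⟨fun _ ↦ ⟨Iso.refl _⟩, fun ⟨e⟩ ↦ ⟨e.symm⟩, fun ⟨e⟩ ⟨e'⟩ ↦ ⟨e ≪≫ e'⟩⟩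

/-- The set `Cl(Y)` of isomorphism classes of rank-one reflexive sheaves on `Y`. -/
def Cl (Y : Scheme.{u}) : Type (u + 1) := Quotient (clSetoid Y)

/-- The class `[M]` of a rank-one reflexive sheaf. -/
def Cl.mk (M : Y.Modules) (hM : IsRankOneReflexive M) : Cl Y := Quotient.mk (clSetoid Y) ⟨M, hM⟩

/-! ### The Picard group -/

/-- Isomorphism of invertible sheaves. -/
def picSetoid (X : Scheme.{u}) : Setoid {L : X.Modules // IsInvertible L} where
  r L M := Nonempty (L.1 ≅ M.1)
  iseqv := ⟨fun _ ↦ ⟨Iso.refl _⟩, fun ⟨e⟩ ↦ ⟨e.symm⟩, fun ⟨e⟩ ⟨e'⟩ ↦ ⟨e ≪≫ e'⟩⟩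

/-- The Picard group: isomorphism classes of invertible sheaves. -/
def Pic (X : Scheme.{u}) : Type (u + 1) := Quotient (picSetoid X)

namespace Pic

/-- The class `[L]` of an invertible sheaf. -/
def mk (L : X.Modules) (hL : IsInvertible L) : Pic X := Quotient.mk (picSetoid X) ⟨L, hL⟩

lemma mk_eq_mk {L M : X.Modules} {hL : IsInvertible L} {hM : IsInvertible M} :
    mk L hL = mk M hM ↔ Nonempty (L ≅ M) := Quotient.eq (r := picSetoid X)

instance : Add (Pic X) where
  add := Quotient.map₂ (fun L M ↦ ⟨tensor L.1 M.1, L.2.tensor M.2⟩)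
    fun _ _ ⟨e⟩ _ _ ⟨e'⟩ ↦ ⟨tensorCongr e e'⟩

lemma mk_add_mk (L M : X.Modules) (hL : IsInvertible L) (hM : IsInvertible M) :
    mk L hL + mk M hM = mk (tensor L M) (hL.tensor hM) := rfl

instance : Zero (Pic X) where
  zero := mk (unitM X) isInvertible_unit

instance addCommMonoid : AddCommMonoid (Pic X) where
  nsmul := nsmulRec
  add_assoc := by
    rintro ⟨L⟩ ⟨M⟩ ⟨N⟩
    exact Quotient.sound (tensorAssoc L.2 M.2 N.2)
  zero_add := by
    rintro ⟨L⟩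
    exact Quotient.sound (unitTensor L.2)
  add_zero := by
    rintro ⟨L⟩
    exact Quotient.sound ((unitTensor L.2).map fun e ↦ tensorComm _ _ ≪≫ e)
  add_comm := by
    rintro ⟨L⟩ ⟨M⟩
    exact Quotient.sound ⟨tensorComm _ _⟩

lemma mk_dual_add_mk (L : X.Modules) (hL : IsInvertible L) :
    mk (dual L) hL.dual + mk L hL = 0 := Quotient.sound (dualTensor hL)

instance : Neg (Pic X) where
  neg := Quotient.lift (fun L ↦ mk (dual L.1) L.2.dual) fun L M h ↦ by
    refine left_neg_eq_right_neg (mk_dual_add_mk L.1 L.2) ?_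
    have h' : mk L.1 L.2 = mk M.1 M.2 := mk_eq_mk.2 h
    rw [h', add_comm, mk_dual_add_mk]

instance : AddCommGroup (Pic X) where
  __ := addCommMonoid
  zsmul := zsmulRec
  neg_add_cancel := by
    rintro ⟨L⟩
    exact mk_dual_add_mk L.1 L.2

/-- The restriction homomorphism `Pic(Y) → Pic(X)` along an open immersion `X ⟶ Y`. -/
def restrict (f : X ⟶ Y) [IsOpenImmersion f] : Pic Y →+ Pic X where
  toFun := Quotient.map (fun L ↦ ⟨L.1.restrict f, L.2.restrict f⟩)
    fun _ _ ⟨e⟩ ↦ ⟨(Modules.restrictFunctor f).mapIso e⟩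
  map_zero' := Quotient.sound (restrictUnit f)
  map_add' := by
    rintro ⟨L⟩ ⟨M⟩
    exact Quotient.sound (restrictTensor f L.2 M.2)

lemma restrict_mk (f : X ⟶ Y) [IsOpenImmersion f] (L : Y.Modules) (hL : IsInvertible L) :
    restrict f (mk L hL) = mk (L.restrict f) (hL.restrict f) := rfl

lemma restrict_id (f : X ⟶ X) [IsOpenImmersion f] (hf : f = 𝟙 X) (L : Pic X) :
    restrict f L = L := by
  subst hf
  obtain ⟨L, rfl⟩ := Quotient.exists_rep L
  exact Quotient.sound ⟨Modules.restrictFunctorId.app L.1⟩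

lemma restrict_comp {Z : Scheme.{u}} (f : X ⟶ Y) (g : Y ⟶ Z) (h : X ⟶ Z) [IsOpenImmersion f]
    [IsOpenImmersion g] [IsOpenImmersion h] (w : h = f ≫ g) (L : Pic Z) :
    restrict f (restrict g L) = restrict h L := by
  subst w
  obtain ⟨L, rfl⟩ := Quotient.exists_rep L
  exact Quotient.sound ⟨((Modules.restrictFunctorComp f g).app L.1).symm⟩

end Pic

/-! ### The direct limit of the groups `Pic(U)` -/

/-- The codimension in `X` of a closed subset `Z`: the infimum over the points `z ∈ Z` of
`dim 𝒪_{X,z}` (the supremum of the lengths of chains of generizations of `z`);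
it is `⊤` if `Z` is empty. -/
def codim {X : Scheme.{u}} (Z : Set X) : ℕ∞ := ⨅ z ∈ Z, Order.coheight z

/-- The open subsets `U` of `Y` with `codim_Y (Y \ U) ≥ 2`. -/
def BigOpens (Y : Scheme.{u}) : Type u := {U : Y.Opens // 2 ≤ codim (U : Set Y)ᶜ}

namespace BigOpens

/-- Reverse inclusion: `U ≤ V` means `V ⊆ U`. -/
instance : PartialOrder (BigOpens Y) :=
  PartialOrder.lift (fun U ↦ OrderDual.toDual U.1) fun _ _ h ↦ Subtype.ext h

instance : Nonempty (BigOpens Y) := ⟨⟨⊤, by simp [codim]⟩⟩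

instance : IsDirectedOrder (BigOpens Y) where
  directed U V := ⟨⟨U.1 ⊓ V.1, by
    have hU := U.2
    have hV := V.2
    simp only [codim, le_iInf_iff, Set.mem_compl_iff, SetLike.mem_coe, Opens.mem_inf] at hU hV ⊢
    intro z hz
    by_cases h : z ∈ U.1
    · exact hV z fun h' ↦ hz ⟨h, h'⟩
    · exact hU z h⟩, inf_le_left (α := Y.Opens), inf_le_right (α := Y.Opens)⟩

/-- The restriction homomorphism `Pic(U) → Pic(V)` for `V ⊆ U`. -/
def picMap (U V : BigOpens Y) (h : U ≤ V) : Pic U.1 →+ Pic V.1 :=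
  Pic.restrict (Y.homOfLE (show V.1 ≤ U.1 from h))

instance : DirectedSystem (fun U : BigOpens Y ↦ Pic U.1) (picMap · · ·) where
  map_self U L := Pic.restrict_id _ (by simp) L
  map_map U V W h h' L := Pic.restrict_comp _ _ _ (by simp) L

end BigOpens

/-- The direct limit of `Pic(U)` over the open subsets `U` with `codim_Y (Y \ U) ≥ 2`. -/
abbrev PicLimit (Y : Scheme.{u}) : Type (u + 1) :=
  DirectLimit (fun U : BigOpens Y ↦ Pic U.1) (BigOpens.picMap (Y := Y))

/-- The canonical homomorphism from `Pic(U)` to the direct limit. -/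
def PicLimit.of (U : BigOpens Y) : Pic U.1 →+ PicLimit Y where
  toFun L := ⟦⟨U, L⟩⟧
  map_zero' := (DirectLimit.zero_def U).symm
  map_add' L M := (DirectLimit.add_def (G := fun U : BigOpens Y ↦ Pic U.1)
    (f := BigOpens.picMap (Y := Y)) U L M).symm

end AlgebraicGeometry.Scheme

end

/-! Everything rests on one property of a sheaf: unique extension of sections across closed subsets
of codimension at least two (`ExtendsInCodimTwo`). The structure sheaf of a locally Krull scheme has
it, since a Krull domain is the intersection of its localizations at height-one primes
(`extendsInCodimTwo_unit`). Every dual inherits it from the structure sheaf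
(`extendsInCodimTwo_dual`), hence so does every reflexive sheaf, being isomorphic to its bidual. A
sheaf with this property is the pushforward of its restriction to any open `U` whose complement has
codimension at least two, so it is determined by that restriction.

Rank-one reflexive sheaves are exactly the sheaves with this property that are invertible near every
point of codimension at most one. In one direction, on a Krull chart a rank-one lattice is
isomorphic to a nonzero ideal `I`. At a prime `p` of height at most one some `g ∈ I` generates `I`
locally, and because only finitely many height-one primes contain `g`, a single `f ∉ p` makes `g`
generate `I` over `D(f)` (`exists_generator`, `hasGenAt_of_isRankOneReflexive`). Conversely, let `F`
extend sections and be invertible in codimension one. An affine open with a domain of sections is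
covered up to codimension two by finitely many basic opens on which `F` is free. Finiteness bounds
all denominators, which gives quasi-coherence and embeds the sections of `F` in the ring. The map to
the bidual is an isomorphism because it is one where `F` is invertible
(`isRankOneReflexive_of_extendsInCodimTwo`).

So a rank-one reflexive sheaf is invertible on a big open subset, and restricting it there defines
the map to the limit of Picard groups. It is injective since the sheaf is the pushforward of its
restriction, and surjective since the pushforward of an invertible sheaf from a big open subset
meets the criterion. Tensor product and bidual are compatible with restriction to the locus of
invertibility, so the map turns the bidual tensor product into addition, and the group axioms can be
transported from the limit. -/

noncomputable section

/-! ### Divisibility and local generators of ideals in Krull domains -/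

namespace IsKrullDomain

variable {A : Type u} [CommRing A]

lemma exists_pow_mul_eq (hA : IsKrullDomain A) {q : Ideal A} [q.IsPrime] (hq : q.height = 1)
    {b h : A} (hb : b ≠ 0) (hh : h ∈ q) : ∃ m, ∃ t ∉ q, b ∣ h ^ m * t := by
  have := hA.isDomain
  obtain ⟨_, _⟩ := hA.isDiscreteValuationRing q hq
  let B := Localization.AtPrime q
  have hb' : algebraMap A B b ≠ 0 := fun h0 ↦ hb <|
    IsLocalization.injective B q.primeCompl_le_nonZeroDivisors (h0.trans (map_zero _).symm)
  obtain ⟨ϖ, hϖ⟩ := IsDiscreteValuationRing.exists_irreducible B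
  obtain ⟨n, hn⟩ := IsDiscreteValuationRing.associated_pow_irreducible hb' hϖ
  have hdvd : ϖ ∣ algebraMap A B h := by
    rw [← Ideal.mem_span_singleton, ← hϖ.maximalIdeal_eq]
    exact (IsLocalization.AtPrime.to_map_mem_maximal_iff B q h).2 hh
  obtain ⟨c, hc⟩ := hn.dvd.trans (pow_dvd_pow_of_dvd hdvd n)
  obtain ⟨⟨a, s⟩, hs⟩ := IsLocalization.surj q.primeCompl c
  refine ⟨n, s, s.2, a, IsLocalization.injective B q.primeCompl_le_nonZeroDivisors ?_⟩
  rw [map_mul, map_mul, map_pow, hc, ← hs]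
  ring

/-- The fraction `a / b` lies in every localization at a height-one prime, hence in `A`.
Divisibility in the localization at `q` is written throughout with a witness `t ∉ q`. -/
lemma dvd_of_forall (hA : IsKrullDomain A) {a b : A} (hb : b ≠ 0)
    (h : ∀ q : Ideal A, q.IsPrime → q.height = 1 → ∃ t ∉ q, b ∣ a * t) : b ∣ a := by
  have := hA.isDomain
  let K := FractionRing A
  have hb' : algebraMap A K b ≠ 0 := by simpa using hb
  obtain ⟨c, hc⟩ := hA.eq_iInter (algebraMap A K a / algebraMap A K b) fun q hq hq1 ↦ by
    obtain ⟨t, ht, c, hc⟩ := h q hq hq1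
    refine ⟨c, t, ht, ?_⟩
    rw [div_mul_eq_mul_div, ← map_mul, hc, map_mul, mul_div_cancel_left₀ _ hb']
  refine ⟨c, IsFractionRing.injective A K ?_⟩
  rw [map_mul, hc, mul_div_cancel₀ _ hb']

/-- Only finitely many height-one primes contain `b`. At those that also contain `h`, a large power
of `h` has at least the valuation of `b`, and the maximum of these exponents works for all `a` at
once. In effect, a fraction `a / b` regular in codimension one on `D(h)` becomes regular after
multiplication by `h ^ m`. -/
lemma exists_dvd_pow_mul (hA : IsKrullDomain A) {b : A} (hb : b ≠ 0) (h : A) :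
    ∃ m, ∀ a, (∀ q : Ideal A, q.IsPrime → q.height = 1 → b ∈ q → h ∉ q → ∃ t ∉ q, b ∣ a * t) →
      b ∣ h ^ m * a := by
  have := hA.isDomain
  have key (q : {p : Ideal A | p.IsPrime ∧ p.height = 1 ∧ b ∈ p}) :
      ∃ m, h ∈ q.1 → ∃ t ∉ q.1, b ∣ h ^ m * t := by
    have := q.2.1
    by_cases hh : h ∈ q.1
    · obtain ⟨m, hm⟩ := hA.exists_pow_mul_eq q.2.2.1 hb hh
      exact ⟨m, fun _ ↦ hm⟩
    · exact ⟨0, fun h' ↦ (hh h').elim⟩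
  choose n hn using key
  have := (hA.finite b hb).to_subtype
  obtain ⟨m, hm⟩ := (Set.finite_range n).bddAbove
  refine ⟨m, fun a ha ↦ hA.dvd_of_forall hb fun q hq hq1 ↦ ?_⟩
  by_cases hbq : b ∈ q
  · by_cases hh : h ∈ q
    · obtain ⟨t, ht, hd⟩ := hn ⟨q, hq, hq1, hbq⟩ hh
      refine ⟨t, ht, ?_⟩
      rw [mul_right_comm]
      refine (hd.trans (mul_dvd_mul_right (pow_dvd_pow h ?_) t)).mul_right a
      exact hm ⟨⟨q, hq, hq1, hbq⟩, rfl⟩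
    · obtain ⟨t, ht, hd⟩ := ha q hq hq1 hbq hh
      exact ⟨t, ht, by rw [mul_assoc]; exact hd.mul_left _⟩
  -- Away from the primes containing `b`, the element `b` itself is a legitimate denominator.
  · exact ⟨b, hbq, dvd_mul_left _ _⟩

/-- In height one the extended ideal is principal in a discrete valuation ring, and its generator
can be moved into `I` by a unit. In height zero the localization is the fraction field and any
nonzero element of `I` will do. -/
lemma exists_mem_local_generator (hA : IsKrullDomain A) {p : Ideal A} [p.IsPrime]
    (hp : p.height ≤ 1) {I : Ideal A} (hI : I ≠ ⊥) :
    ∃ g ∈ I, g ≠ 0 ∧ ∀ i ∈ I, ∃ t ∉ p, g ∣ i * t := by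
  have := hA.isDomain
  rcases hp.lt_or_eq with hp | hp
  · obtain ⟨g, hg, hg0⟩ := (Submodule.ne_bot_iff _).1 hI
    refine ⟨g, hg, hg0, fun i _ ↦ ⟨g, ?_, dvd_mul_left _ _⟩⟩
    have : p = ⊥ := by
      exact Ideal.height_eq_zero_iff_eq_bot.1 (Order.lt_one_iff.1 hp)
    rw [this]
    exact hg0
  · obtain ⟨_, _⟩ := hA.isDiscreteValuationRing p hp
    let B := Localization.AtPrime p
    have inj := IsLocalization.injective B p.primeCompl_le_nonZeroDivisors
    obtain ⟨y, hy⟩ := IsPrincipalIdealRing.principal (I.map (algebraMap A B))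
    have hy' : y ∈ I.map (algebraMap A B) := hy ▸ Submodule.mem_span_singleton_self y
    obtain ⟨⟨⟨g, hg⟩, s⟩, hs⟩ :=
      (IsLocalization.mem_map_algebraMap_iff p.primeCompl B).1 hy'
    dsimp only at hs
    have hsu := IsLocalization.map_units B s
    have hgI (i : A) (hi : i ∈ I) : algebraMap A B g ∣ algebraMap A B i := by
      have : algebraMap A B i ∈ I.map (algebraMap A B) := Ideal.mem_map_of_mem _ hi
      rw [hy] at this
      rw [← hs, hsu.mul_right_dvd]
      exact Ideal.mem_span_singleton.1 this
    refine ⟨g, hg, ?_, fun i hi ↦ ?_⟩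
    · rintro rfl
      refine hI ((Submodule.eq_bot_iff _).2 fun i hi ↦ inj ?_)
      simpa using hgI i hi
    · obtain ⟨c, hc⟩ := hgI i hi
      obtain ⟨⟨a, s⟩, hs⟩ := IsLocalization.surj p.primeCompl c
      refine ⟨s, s.2, a, inj ?_⟩
      rw [map_mul, map_mul, hc, ← hs]
      ring

/-- Spreads a generator at `p` out to a neighbourhood `D(f)` without assuming `I` finitely
generated: besides `p`, only finitely many height-one primes contain `g`, and `f` is chosen outside
`p` but inside each of them. The exponent `m` does not depend on `i`. -/
lemma exists_generator (hA : IsKrullDomain A) {p : Ideal A} [p.IsPrime]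
    (hp : p.height ≤ 1) {I : Ideal A} (hI : I ≠ ⊥) :
    ∃ g ∈ I, g ≠ 0 ∧ ∃ f ∉ p, ∃ m, ∀ i ∈ I, g ∣ f ^ m * i := by
  have := hA.isDomain
  obtain ⟨g, hg, hg0, hgI⟩ := hA.exists_mem_local_generator hp hI
  have fin := hA.finite g hg0
  have key (q : Ideal A) : ∃ f ∉ p, q.IsPrime → q.height = 1 → q ≠ p → f ∈ q := by
    by_cases h : q.IsPrime ∧ q.height = 1 ∧ q ≠ p
    · obtain ⟨h1, h2, h3⟩ := h
      -- A proper inclusion `q < p` would force the height of `p` to be at least two.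
      have : ¬ q ≤ p := fun hle ↦ by
        have hlt : q < p := lt_of_le_of_ne hle h3
        have := Ideal.height_add_one_le_of_lt_of_isPrime hlt
        rw [h2] at this
        exact absurd (this.trans hp) (by decide)
      obtain ⟨f, hf, hfp⟩ := Set.not_subset.1 this
      exact ⟨f, hfp, fun _ _ _ ↦ hf⟩
    · exact ⟨1, p.one_notMem, fun h1 h2 h3 ↦ (h ⟨h1, h2, h3⟩).elim⟩
  choose φ hφ hφ' using key
  obtain ⟨m, hm⟩ := hA.exists_dvd_pow_mul hg0 (∏ q ∈ fin.toFinset, φ q)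
  refine ⟨g, hg, hg0, ∏ q ∈ fin.toFinset, φ q, fun h ↦ ?_, m, fun i hi ↦ hm i fun q hq hq1 hgq hf ↦ ?_⟩
  · obtain ⟨q, -, hq⟩ := Ideal.IsPrime.prod_mem_iff.1 h
    exact hφ q hq
  · by_cases hqp : q = p
    · subst hqp
      exact hgI i hi
    · refine (hf (Ideal.mem_of_dvd _ (Finset.dvd_prod_of_mem φ (a := q) ?_)
        (hφ' q hq hq1 hqp))).elim
      exact fin.mem_toFinset.2 ⟨hq, hq1, hgq⟩

end IsKrullDomain

/-! ### Rank-one lattices as ideals -/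

/-- A non-torsion element of a finitely generated module over a domain is not killed by some
linear form. -/
lemma exists_linearForm_ne_zero {A P : Type*} (K : Type*) [CommRing A] [IsDomain A] [Field K]
    [Algebra A K] [IsFractionRing A K] [AddCommGroup P] [Module A P] [Module.Finite A P] {p : P}
    (hp : ∀ a : A, a ≠ 0 → a • p ≠ 0) : ∃ φ : P →ₗ[A] A, φ p ≠ 0 := by
  let S := nonZeroDivisors A
  let loc : P →ₗ[A] TensorProduct A K P := TensorProduct.mk A K P 1
  have hne : loc p ≠ 0 := fun h ↦ by
    obtain ⟨c, hc⟩ := (IsLocalizedModule.eq_zero_iff S loc).1 h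
    exact hp c.1 (nonZeroDivisors.coe_ne_zero c) hc
  obtain ⟨l, hl⟩ := Module.Projective.exists_dual_ne_zero K hne
  obtain ⟨s, hs⟩ := Module.Finite.fg_top (R := A) (M := P)
  classical
  -- A common denominator `d` for the values of `l` on a finite generating set turns the `K`-valued
  -- form into an `A`-valued one.
  obtain ⟨d, hd⟩ := IsLocalization.exist_integer_multiples_of_finset S
    (s.image fun p ↦ l (loc p))
  have mem (p : P) : d.1 • l (loc p) ∈ LinearMap.range (Algebra.linearMap A K) := by
    have : p ∈ Submodule.span A (s : Set P) := hs ▸ Submodule.mem_top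
    induction this using Submodule.span_induction with
    | mem x hx =>
      obtain ⟨a, ha⟩ := hd _ (Finset.mem_image_of_mem _ hx)
      exact ⟨a, ha⟩
    | zero => simp
    | add x y _ _ hx hy => simpa only [map_add, smul_add] using add_mem hx hy
    | smul a x _ hx =>
      have : l (loc (a • x)) = a • l (loc x) := by
        rw [map_smul, ← algebraMap_smul K a (loc x), map_smul, algebraMap_smul]
      rw [this, smul_comm]
      exact Submodule.smul_mem _ a hx
  let e := LinearEquiv.ofInjective (Algebra.linearMap A K) (IsFractionRing.injective A K)
  let L : P →ₗ[A] K := (d.1 • (l.restrictScalars A)) ∘ₗ loc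
  refine ⟨e.symm.toLinearMap ∘ₗ L.codRestrict _ mem, fun h ↦ ?_⟩
  have h1 : L.codRestrict _ mem p = 0 := e.symm.map_eq_zero_iff.1 h
  have h2 : d.1 • l (loc p) = 0 := congrArg Subtype.val h1
  rw [Algebra.smul_def, mul_eq_zero] at h2
  exact h2.elim (by simp) hl

/-- A linear form on the ambient finitely generated module that is nonzero at the image of `n₀` is
injective on `N`, because every element of `N` is proportional to `n₀` and `N` is torsion-free. Thus
`N` is isomorphic to an ideal. -/
lemma IsModuleLattice.exists_injective {A : Type u} [CommRing A] [IsDomain A] {N : Type u}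
    [AddCommGroup N] [Module A N] (hN : IsModuleLattice A N) {n₀ : N} (hn₀ : n₀ ≠ 0)
    (hdep : ∀ n : N, ∃ a b : A, (a ≠ 0 ∨ b ≠ 0) ∧ a • n = b • n₀) :
    ∃ φ : N →ₗ[A] A, Function.Injective φ := by
  obtain ⟨htf, P, hP, ι, hι⟩ := hN
  obtain ⟨ψ, hψ⟩ := exists_linearForm_ne_zero (FractionRing A) (p := ι n₀) fun a ha h ↦
    hn₀ ((smul_eq_zero_iff_right ha).1 (hι (by rw [map_smul, map_zero]; exact h)))
  refine ⟨ψ ∘ₗ ι, (injective_iff_map_eq_zero _).2 fun n hn ↦ ?_⟩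
  obtain ⟨a, b, hab, h⟩ := hdep n
  have hb : b = 0 := by
    have := congrArg (ψ ∘ₗ ι) h
    rw [map_smul, map_smul, hn, smul_zero, smul_eq_mul, eq_comm, mul_eq_zero] at this
    exact this.resolve_right hψ
  rw [hb, zero_smul] at h
  exact (smul_eq_zero_iff_right (hab.resolve_right (· hb))).1 h

namespace AlgebraicGeometry.Scheme.Modules

variable {X : Scheme.{u}}

/-! ### Restriction maps and gluing -/

/-- Restriction of sections of a sheaf of modules. -/
def mres (M : X.Modules) {V W : X.Opens} (h : W ≤ V) : Γ(M, V) →+ Γ(M, W) :=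
  (M.presheaf.map (homOfLE h).op).hom

/-- Restriction of functions. -/
def ores {V W : X.Opens} (h : W ≤ V) : Γ(X, V) →+* Γ(X, W) :=
  (X.presheaf.map (homOfLE h).op).hom

lemma mres_mres (M : X.Modules) {U V W : X.Opens} (h : V ≤ U) (h' : W ≤ V) (m : Γ(M, U)) :
    mres M h' (mres M h m) = mres M (h'.trans h) m := res_res M h h' m

lemma ores_ores {U V W : X.Opens} (h : V ≤ U) (h' : W ≤ V) (m : Γ(X, U)) :
    ores h' (ores h m) = ores (h'.trans h) m := resO_resO h h' m

lemma mres_self (M : X.Modules) {U : X.Opens} (m : Γ(M, U)) : mres M le_rfl m = m :=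
  congrArg (fun f ↦ f.hom m) (M.presheaf.map_id (op U))

lemma ores_self {U : X.Opens} (m : Γ(X, U)) : ores le_rfl m = m :=
  congrArg (fun f ↦ f.hom m) (X.presheaf.map_id (op U))

lemma mres_smul (M : X.Modules) {V W : X.Opens} (h : W ≤ V) (a : Γ(X, V)) (m : Γ(M, V)) :
    mres M h (a • m) = ores h a • mres M h m := map_smul M (homOfLE h) a m

lemma mres_app {M N : X.Modules} (φ : M ⟶ N) {V W : X.Opens} (h : W ≤ V) (m : Γ(M, V)) :
    φ.app W (mres M h m) = mres N h (φ.app V m) :=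
  PresheafOfModules.naturality_apply φ.val (homOfLE h).op m

lemma IsGen.mres {M : X.Modules} {V : X.Opens} {g : Γ(M, V)} (hg : IsGen M.val V g)
    {W : X.Opens} (h : W ≤ V) : IsGen M.val W (mres M h g) := hg.res h

lemma IsGen.exists_smul_eq {M : X.Modules} {V : X.Opens} {g : Γ(M, V)} (hg : IsGen M.val V g)
    {W : X.Opens} (h : W ≤ V) (m : Γ(M, W)) : ∃ a : Γ(X, W), a • Modules.mres M h g = m :=
  (hg W h).2 m

lemma IsGen.smul_injective {M : X.Modules} {V : X.Opens} {g : Γ(M, V)} (hg : IsGen M.val V g)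
    {W : X.Opens} (h : W ≤ V) {a b : Γ(X, W)}
    (hab : a • Modules.mres M h g = b • Modules.mres M h g) : a = b :=
  (hg W h).1 hab

lemma eq_of_locally (M : X.Modules) {V : X.Opens} {s t : Γ(M, V)}
    (h : ∀ x ∈ V, ∃ W, ∃ i : W ≤ V, x ∈ W ∧ mres M i s = mres M i t) : s = t := by
  choose W i hx he using h
  exact TopCat.Sheaf.eq_of_locally_eq' (⟨M.presheaf, M.isSheaf⟩ : TopCat.Sheaf Ab X)
    (fun x : V ↦ W x.1 x.2) V (fun x ↦ homOfLE (i x.1 x.2))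
    (fun x hx' ↦ Opens.mem_iSup.2 ⟨⟨x, hx'⟩, hx x hx'⟩) s t fun x ↦ he _ _

lemma eq_of_locally_fun {V : X.Opens} {s t : Γ(X, V)}
    (h : ∀ x ∈ V, ∃ W, ∃ i : W ≤ V, x ∈ W ∧ ores i s = ores i t) : s = t :=
  eq_of_locally (unitM X) h

lemma exists_glue (M : X.Modules) {ι : Type u} (U : ι → X.Opens) (t : ∀ i, Γ(M, U i))
    (h : ∀ i j, mres M (inf_le_left : U i ⊓ U j ≤ U i) (t i) =
      mres M (inf_le_right : U i ⊓ U j ≤ U j) (t j)) :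
    ∃ s : Γ(M, iSup U), ∀ i, mres M (le_iSup U i) s = t i := by
  obtain ⟨s, hs, -⟩ := TopCat.Sheaf.existsUnique_gluing'
    (⟨M.presheaf, M.isSheaf⟩ : TopCat.Sheaf Ab X) U (iSup U) (fun i ↦ homOfLE (le_iSup U i))
    le_rfl t h
  exact ⟨s, hs⟩

/-! ### Extension of sections in codimension two -/

/-- Sections of `M` extend uniquely over closed subsets of codimension at least two. -/
def ExtendsInCodimTwo (M : X.Modules) : Prop :=
  ∀ (V W : X.Opens) (h : W ≤ V), (∀ z ∈ V, z ∉ W → 2 ≤ Order.coheight z) →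
    Function.Bijective (mres M h)

/-- `M` is invertible in a neighbourhood of `x`. -/
def HasGenAt (M : X.Modules) (x : X) : Prop :=
  ∃ V : X.Opens, x ∈ V ∧ ∃ g : Γ(M, V), IsGen M.val V g

lemma ExtendsInCodimTwo.of_iso {M N : X.Modules} (e : M ≅ N) (hM : ExtendsInCodimTwo M) :
    ExtendsInCodimTwo N := fun V W h hz ↦ by
  have key (U : X.Opens) : Function.Bijective (e.hom.app U) :=
    ConcreteCategory.bijective_of_isIso _
  refine (Function.Bijective.of_comp_iff _ (key V)).1 ?_
  have : mres N h ∘ e.hom.app V = e.hom.app W ∘ mres M h := funext fun m ↦ (mres_app e.hom h m).symm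
  rw [this]
  exact (key W).comp (hM V W h hz)

lemma dualSections_res {M : X.Modules} {U : X.Opens} (f : dualSections M U) {V W : X.Opens}
    (hV : V ≤ U) (h : W ≤ V) (m : Γ(M, V)) :
    f.1 ⟨W, h.trans hV⟩ (mres M h m) = ores h (f.1 ⟨V, hV⟩ m) :=
  f.2 ⟨V, hV⟩ ⟨W, h.trans hV⟩ h m

/-- Only the target of a linear form has to extend: to evaluate the extended form at `m ∈ M(V')`,
restrict `m` to `V' ⊓ W`, apply `f`, and extend the resulting function to `V'`. -/
lemma extendsInCodimTwo_dual (hX : ExtendsInCodimTwo (unitM X)) (M : X.Modules) :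
    ExtendsInCodimTwo (dual M) := by
  intro V W h hz
  have bij (V' : X.Opens) (hV' : V' ≤ V) :
      Function.Bijective (ores (inf_le_left : V' ⊓ W ≤ V')) :=
    hX V' (V' ⊓ W) inf_le_left fun z hzV hzW ↦ hz z (hV' hzV) fun h' ↦ hzW ⟨hzV, h'⟩
  refine ⟨(injective_iff_map_eq_zero _).2 fun (f : dualSections M V) hf ↦ Subtype.ext <|
    funext fun V' ↦ LinearMap.ext fun m ↦ (bij V'.1 V'.2).1 ?_, fun (f : dualSections M W) ↦ ?_⟩
  · rw [← dualSections_res f V'.2 inf_le_left]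
    have := congrArg (fun f : dualSections M W ↦ f.1 ⟨V'.1 ⊓ W, inf_le_right⟩
      (mres M inf_le_left m)) hf
    exact this.trans (map_zero _).symm
  · let e (V' : {V' : X.Opens // V' ≤ V}) := RingEquiv.ofBijective _ (bij V'.1 V'.2)
    have he (V' : {V' : X.Opens // V' ≤ V}) (a) : ores inf_le_left ((e V').symm a) = a :=
      (e V').apply_symm_apply a
    refine ⟨(⟨fun V' ↦
      { toFun := fun m ↦ (e V').symm (f.1 ⟨V'.1 ⊓ W, inf_le_right⟩
          (mres M (inf_le_left : V'.1 ⊓ W ≤ V'.1) m))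
        map_add' := fun m n ↦ by rw [map_add, map_add, map_add]
        map_smul' := fun a m ↦ (bij V'.1 V'.2).1 (by
          rw [RingHom.id_apply, smul_eq_mul, map_mul, he, he, mres_smul, LinearMap.map_smul,
            smul_eq_mul]) }, fun V' V'' h' m ↦ (bij V''.1 V''.2).1 ?_⟩ : dualSections M V), ?_⟩
    · change ores _ ((e V'').symm (f.1 ⟨V''.1 ⊓ W, inf_le_right⟩ (mres M inf_le_left (mres M h' m)))) =
        ores _ (ores h' ((e V').symm (f.1 ⟨V'.1 ⊓ W, inf_le_right⟩ (mres M inf_le_left m))))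
      rw [he, ores_ores, ← ores_ores (inf_le_left : V'.1 ⊓ W ≤ V'.1) (inf_le_inf_right W h'), he,
        ← dualSections_res f inf_le_right (inf_le_inf_right W h'), mres_mres, mres_mres]
    · refine Subtype.ext <| funext fun V' ↦ LinearMap.ext fun m ↦
        (bij V'.1 (V'.2.trans h)).1 ?_
      change ores _ ((e ⟨V'.1, V'.2.trans h⟩).symm
        (f.1 ⟨V'.1 ⊓ W, inf_le_right⟩ (mres M inf_le_left m))) = ores _ (f.1 V' m)
      rw [he, ← dualSections_res f V'.2 inf_le_left]

/-! ### Local generators under duality, tensor products and restriction -/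

/-- Evaluation at `g` is the element dual to the dual generator `g'`: both take the value `1` at
`g'`, and `g'` generates. -/
lemma IsGen.bidual {M : X.Modules} {V : X.Opens} {g : Γ(M, V)} (hg : IsGen M.val V g) :
    IsGen (dual (dual M)).val V ((Modules.toBidual M).app V g) := by
  obtain ⟨g', hg', h1⟩ := hg.exists_dual
  obtain ⟨g'', hg'', h2⟩ := IsGen.exists_dual (L := dual M) (g := g') hg'
  have : (Modules.toBidual M).app V g = g'' := by
    refine Subtype.ext <| funext fun W ↦ LinearMap.ext fun f ↦ ?_
    obtain ⟨a, rfl⟩ := IsGen.exists_smul_eq (M := dual M) (g := g') hg' W.2 f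
    refine (LinearMap.map_smul _ _ _).trans (Eq.trans ?_ (LinearMap.map_smul _ _ _).symm)
    congr 1
    refine Eq.trans ?_ (dualSections_res (M := dual M) g'' le_rfl W.2 g').symm
    refine Eq.trans ?_ (congrArg (ores W.2) h2).symm
    refine Eq.trans ?_ (congrArg (ores W.2) h1)
    exact (dualSections_res (M := M) g' le_rfl W.2 g)
  rw [this]
  exact hg''

lemma HasGenAt.dual {M : X.Modules} {x : X} (h : HasGenAt M x) : HasGenAt (dual M) x := by
  obtain ⟨V, hV, g, hg⟩ := h
  obtain ⟨g', hg', -⟩ := hg.exists_dual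
  exact ⟨V, hV, g', hg'⟩

lemma HasGenAt.tensor {L M : X.Modules} {x : X} (hL : HasGenAt L x) (hM : HasGenAt M x) :
    HasGenAt (tensor L M) x := by
  obtain ⟨V, hV, g, hg⟩ := hL
  obtain ⟨W, hW, g', hg'⟩ := hM
  exact ⟨V ⊓ W, ⟨hV, hW⟩, _, toShf_gen (gen_tensor (hg.res inf_le_left) (hg'.res inf_le_right))⟩

/-- The open set of points in whose neighbourhood `M` is invertible. -/
def genLocus (M : X.Modules) : X.Opens where
  carrier := {x | HasGenAt M x}
  is_open' := isOpen_iff_forall_mem_open.2 fun _ ⟨V, hV, h⟩ ↦ ⟨V, fun _ hy ↦ ⟨V, hy, h⟩, V.2, hV⟩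

lemma HasGenAt.restrict {Y : Scheme.{u}} (f : Y ⟶ X) [IsOpenImmersion f] {M : X.Modules} {y : Y}
    (h : HasGenAt M (f y)) : HasGenAt (M.restrict f) y := by
  obtain ⟨V, hV, g, hg⟩ := h
  exact ⟨f ⁻¹ᵁ V, hV, _, hg.restrict f (f.image_preimage_le V)⟩

lemma isInvertible_restrict {Y : Scheme.{u}} (f : Y ⟶ X) [IsOpenImmersion f] {M : X.Modules}
    (h : ∀ y, HasGenAt M (f y)) : IsInvertible (M.restrict f) :=
  fun y ↦ (h y).restrict f

lemma hasGenAt_of_restrict {Y : Scheme.{u}} (f : Y ⟶ X) [IsOpenImmersion f] {M : X.Modules} {y : Y}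
    (h : HasGenAt (M.restrict f) y) : HasGenAt M (f y) := by
  obtain ⟨V, hV, g, hg⟩ := h
  refine ⟨f ''ᵁ V, ⟨y, hV, rfl⟩, g, fun W hW ↦ ?_⟩
  -- Every open subset of the image comes from `Y`, so bijectivity on all smaller opens can be
  -- tested in the restricted sheaf, up to the ring isomorphism `f.appIso`.
  obtain ⟨W, rfl⟩ : ∃ W' : Y.Opens, W = f ''ᵁ W' :=
    ⟨f ⁻¹ᵁ W, ((f.image_preimage_eq_opensRange_inf W).trans
      (inf_eq_right.2 (hW.trans (f.image_le_opensRange V)))).symm⟩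
  have hW' : W ≤ V := (f.image_le_image_iff _ _).1 hW
  have key : (fun a : Γ(X, f ''ᵁ W) ↦ (a • mres M hW g : Γ(M, f ''ᵁ W))) =
      (fun a : Γ(Y, W) ↦ HSMul.hSMul (β := Γ(M.restrict f, W)) a (mres (M.restrict f) hW' g)) ∘
        (f.appIso W).hom := funext fun a ↦ by
    refine Eq.trans ?_ (congrArg (fun b : Γ(X, f ''ᵁ W) ↦ b • mres M hW g)
      (ConcreteCategory.congr_hom (f.appIso W).hom_inv_id a).symm)
    rfl
  exact Eq.mpr (congrArg Function.Bijective key)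
    ((hg W hW').comp (ConcreteCategory.bijective_of_isIso (f.appIso W).hom))

lemma isIso_restrict_of_gen {Y : Scheme.{u}} (f : Y ⟶ X) [IsOpenImmersion f] {A B : X.Modules}
    (φ : A ⟶ B) (h : ∀ y : Y, ∃ V : X.Opens, f y ∈ V ∧
      ∃ g : Γ(A, V), IsGen A.val V g ∧ IsGen B.val V (φ.app V g)) :
    IsIso ((restrictFunctor f).map φ) := by
  refine isIso_of_gen _ fun y ↦ ?_
  obtain ⟨V, hV, g, hA, hB⟩ := h y
  refine ⟨f ⁻¹ᵁ V, hV, _, hA.restrict f (f.image_preimage_le V), ?_⟩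
  have := hB.restrict f (f.image_preimage_le V)
  exact Eq.mp (congrArg (IsGen _ _) (mres_app φ (f.image_preimage_le V) g).symm) this

/-- Over `V` the unit is the restriction map from `V` to `V ∩ U`, so a sheaf that extends sections
is the pushforward of its restriction to `U`. -/
lemma isIso_unit_of_extendsInCodimTwo {M : X.Modules} (hM : ExtendsInCodimTwo M) {U : X.Opens}
    (hU : ∀ x, x ∉ U → 2 ≤ Order.coheight x) : IsIso ((restrictAdjunction U.ι).unit.app M) := by
  rw [Hom.isIso_iff_isIso_app]
  intro V
  rw [ConcreteCategory.isIso_iff_bijective]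
  refine hM V _ (U.ι.image_preimage_le V) fun z hz hzU ↦ hU z fun h ↦ hzU ?_
  exact ⟨⟨z, h⟩, hz, rfl⟩

/-- A morphism between sheaves with unique extension of sections in codimension two is an
isomorphism if it is one on the complement of a closed subset of codimension at least two. -/
lemma isIso_of_isIso_restrict {A B : X.Modules} (hA : ExtendsInCodimTwo A)
    (hB : ExtendsInCodimTwo B) {U : X.Opens} (hU : ∀ x, x ∉ U → 2 ≤ Order.coheight x)
    (φ : A ⟶ B) (h : IsIso ((restrictFunctor U.ι).map φ)) : IsIso φ := by
  have h1 := isIso_unit_of_extendsInCodimTwo hA hU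
  have h2 := isIso_unit_of_extendsInCodimTwo hB hU
  have h3 := (restrictAdjunction U.ι).unit.naturality φ
  have : φ = (restrictAdjunction U.ι).unit.app A ≫
      (pushforward U.ι).map ((restrictFunctor U.ι).map φ) ≫
      inv ((restrictAdjunction U.ι).unit.app B) := by
    rw [← Category.assoc, IsIso.eq_comp_inv]
    exact h3
  rw [this]
  infer_instance

lemma isIso_toBidual (hX : ExtendsInCodimTwo (unitM X)) {M : X.Modules}
    (hM : ExtendsInCodimTwo M) (hgen : ∀ x : X, Order.coheight x ≤ 1 → HasGenAt M x) :
    IsIso (toBidual M) := by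
  refine isIso_of_isIso_restrict hM (extendsInCodimTwo_dual hX _) (U := genLocus M)
    (fun x hx ↦ ?_) _ (isIso_restrict_of_gen _ _ fun y ↦ ?_)
  · by_contra h
    exact hx (hgen x (Order.le_of_lt_succ (not_le.1 h)))
  · obtain ⟨V, hV, g, hg⟩ : HasGenAt M y.1 := y.2
    exact ⟨V, hV, g, hg, hg.bidual⟩

end AlgebraicGeometry.Scheme.Modules

namespace AlgebraicGeometry

open Scheme Modules

variable {Y : Scheme.{u}}

/-! ### Points and functions on affine opens -/

namespace IsAffineOpen

variable {V : Y.Opens} (hV : IsAffineOpen V)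

include hV

lemma mem_basicOpen_iff (x : V) (f : Γ(Y, V)) :
    x.1 ∈ Y.basicOpen f ↔ f ∉ (hV.primeIdealOf x).asIdeal := by
  conv_lhs => rw [← hV.fromSpec_primeIdealOf x]
  change hV.primeIdealOf x ∈ hV.fromSpec ⁻¹ᵁ (Y.basicOpen f) ↔ _
  rw [hV.fromSpec_preimage_basicOpen]
  rfl

/-- The dictionary between heights of primes, in which Krull domains are defined, and the intrinsic
codimension of points of `Y`. -/
lemma height_primeIdealOf (x : V) :
    (hV.primeIdealOf x).asIdeal.height = Order.coheight x.1 := by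
  refine (idealHeight_eq_coheight Γ(Y, V) (hV.primeIdealOf x)).trans ?_
  conv_rhs => rw [← hV.fromSpec_primeIdealOf x]
  exact (coheight_eq_of_isOpenImmersion hV.fromSpec).symm

lemma primeIdealOf_injective : Function.Injective hV.primeIdealOf := fun x y h ↦
  Subtype.ext (by rw [← hV.fromSpec_primeIdealOf x, h, hV.fromSpec_primeIdealOf y])

lemma exists_primeIdealOf_eq (q : Ideal Γ(Y, V)) [q.IsPrime] :
    ∃ x : V, (hV.primeIdealOf x).asIdeal = q := by
  let y : Spec Γ(Y, V) := ⟨q, inferInstance⟩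
  have hy : hV.fromSpec y ∈ V := by
    have : hV.fromSpec y ∈ hV.fromSpec.opensRange := ⟨y, rfl⟩
    rwa [hV.opensRange_fromSpec] at this
  refine ⟨⟨_, hy⟩, ?_⟩
  have : hV.primeIdealOf ⟨_, hy⟩ = y :=
    hV.fromSpec.isOpenEmbedding.injective (hV.fromSpec_primeIdealOf _)
  rw [this]

lemma exists_mem_basicOpen_le {x : Y} (hx : x ∈ V) {W : Y.Opens} (hW : x ∈ W) :
    ∃ f : Γ(Y, V), Y.basicOpen f ≤ W ∧ x ∈ Y.basicOpen f :=
  hV.exists_basicOpen_le ⟨x, hW⟩ hx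

lemma exists_pow_mul_eq (f : Γ(Y, V)) {W : Y.Opens} (h : W ≤ V) (hW : W = Y.basicOpen f)
    (s : Γ(Y, W)) : ∃ n a, ores h a = ores h f ^ n * s := by
  let _ : Algebra Γ(Y, V) Γ(Y, W) := (Y.presheaf.map (homOfLE h).op).hom.toAlgebra
  have := hV.isLocalization_of_eq_basicOpen f (homOfLE h) hW
  obtain ⟨⟨a, _, n, rfl⟩, ha⟩ := IsLocalization.surj (Submonoid.powers f) s
  refine ⟨n, a, ha.symm.trans ((mul_comm _ _).trans ?_)⟩
  exact congrArg (· * s) (map_pow (ores h) f n)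

lemma exists_pow_mul_eq_zero (f : Γ(Y, V)) {W : Y.Opens} (h : W ≤ V) (hW : W = Y.basicOpen f)
    {a : Γ(Y, V)} (ha : ores h a = 0) : ∃ n, f ^ n * a = 0 := by
  let _ : Algebra Γ(Y, V) Γ(Y, W) := (Y.presheaf.map (homOfLE h).op).hom.toAlgebra
  have := hV.isLocalization_of_eq_basicOpen f (homOfLE h) hW
  obtain ⟨⟨_, n, rfl⟩, hc⟩ := (IsLocalization.map_eq_zero_iff (Submonoid.powers f) Γ(Y, W) a).1 ha
  exact ⟨n, hc⟩

omit hV in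
lemma isUnit_ores (f : Γ(Y, V)) {W : Y.Opens} (h : W ≤ V) (hW : W ≤ Y.basicOpen f) :
    IsUnit (ores h f) := by
  have := (RingedSpace.isUnit_res_basicOpen _ f).map (ores hW)
  convert this using 1
  exact (ores_ores (Y.basicOpen_le f) hW f).symm

omit hV in
lemma ne_zero_of_mem {f : Γ(Y, V)} {x : Y} (hx : x ∈ Y.basicOpen f) : f ≠ 0 := by
  rintro rfl
  rw [Y.basicOpen_zero] at hx
  exact hx

variable [IsDomain Γ(Y, V)]

/-- The generic point of an affine open set with a domain of sections. -/
lemma exists_generic : ∃ η : Y, Order.coheight η = 0 ∧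
    ∀ f : Γ(Y, V), f ≠ 0 → η ∈ Y.basicOpen f := by
  obtain ⟨η, hη⟩ := hV.exists_primeIdealOf_eq ⊥
  refine ⟨η, ?_, fun f hf ↦ (hV.mem_basicOpen_iff η f).2 (by rwa [hη])⟩
  rw [← hV.height_primeIdealOf, hη, Ideal.height_bot]

/-- Identity principle: near any point of `W` the function is a fraction `c / f ^ n` with `c` a
section over `V`. Since `c` vanishes on a nonempty basic open and the sections over `V` form a
domain, `c` is zero. -/
lemma eq_zero_of_ores {W W' : Y.Opens} (hW : W ≤ V) (h : W' ≤ W) {z : Y} (hz : z ∈ W')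
    {a : Γ(Y, W)} (ha : ores h a = 0) : a = 0 := by
  refine eq_of_locally_fun fun x hx ↦ ?_
  obtain ⟨f, hf, hxf⟩ := hV.exists_mem_basicOpen_le (hW hx) hx
  obtain ⟨k, hk, hzk⟩ := hV.exists_mem_basicOpen_le (hW (h hz)) hz
  refine ⟨_, hf, hxf, ?_⟩
  obtain ⟨n, c, hc⟩ := hV.exists_pow_mul_eq f (Y.basicOpen_le f) rfl (ores hf a)
  have hc0 : c = 0 := by
    have h0 : ores (Y.basicOpen_le (f * k)) c = 0 := by
      have e : Y.basicOpen (f * k) = Y.basicOpen f ⊓ Y.basicOpen k := Y.basicOpen_mul f k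
      have h1 : Y.basicOpen (f * k) ≤ Y.basicOpen f := e.le.trans inf_le_left
      have h2 : Y.basicOpen (f * k) ≤ W' := (e.le.trans inf_le_right).trans hk
      rw [← ores_ores (Y.basicOpen_le f) h1, hc, map_mul, ores_ores, ← ores_ores h h2, ha, map_zero,
        mul_zero]
    obtain ⟨m, hm⟩ := hV.exists_pow_mul_eq_zero (f * k) _ rfl h0
    refine (mul_eq_zero.1 hm).resolve_left (pow_ne_zero _ (mul_ne_zero ?_ ?_))
    exacts [ne_zero_of_mem hxf, ne_zero_of_mem hzk]
  rw [hc0, map_zero, eq_comm, ((isUnit_ores f _ le_rfl).pow n).mul_right_eq_zero] at hc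
  rw [hc, map_zero]

lemma eq_of_ores {W W' : Y.Opens} (hW : W ≤ V) (h : W' ≤ W) {z : Y} (hz : z ∈ W')
    {a b : Γ(Y, W)} (hab : ores h a = ores h b) : a = b :=
  sub_eq_zero.1 <| hV.eq_zero_of_ores hW h hz (by rw [map_sub, hab, sub_self])

lemma ores_ne_zero {W : Y.Opens} (hW : W ≤ V) {z : Y} (hz : z ∈ W) {a : Γ(Y, V)} (ha : a ≠ 0) :
    ores hW a ≠ 0 := fun h ↦ ha (hV.eq_zero_of_ores le_rfl hW hz h)

end IsAffineOpen

/-! ### Functions on locally Krull schemes -/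

namespace Scheme.IsLocallyKrull

variable (hY : Y.IsLocallyKrull)

include hY

/-- Small neighbourhoods are taken basic inside a Krull chart `U`. Working with fractions over `U`
makes it unnecessary to show that localizations of Krull domains are Krull. -/
lemma exists_basicOpen {V : Y.Opens} {x : Y} (hx : x ∈ V) : ∃ U : Y.Opens, IsAffineOpen U ∧
    IsKrullDomain Γ(Y, U) ∧ ∃ h : Γ(Y, U), x ∈ Y.basicOpen h ∧ Y.basicOpen h ≤ V := by
  obtain ⟨U, hxU, hU, hK⟩ := hY x
  obtain ⟨h, hh, hxh⟩ := hU.exists_mem_basicOpen_le hxU hx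
  exact ⟨U, hU, hK, h, hxh, hh⟩

/-- The generic point of a chart has codimension zero, so `W` contains it and the identity principle
applies. -/
lemma ores_injective {V W : Y.Opens} (h : W ≤ V)
    (hz : ∀ z ∈ V, z ∉ W → 2 ≤ Order.coheight z) :
    Function.Injective (ores h) := by
  refine (injective_iff_map_eq_zero _).2 fun a ha ↦ eq_of_locally_fun fun x hx ↦ ?_
  obtain ⟨U, hU, hK, f, hxf, hf⟩ := hY.exists_basicOpen hx
  have := hK.isDomain
  obtain ⟨η, hη0, hη⟩ := hU.exists_generic
  have hηf := hη f (IsAffineOpen.ne_zero_of_mem hxf)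
  have hηW : η ∈ W := by
    by_contra h'
    have := hz η (hf hηf) h'
    rw [hη0] at this
    exact absurd this (by decide)
  refine ⟨_, hf, hxf, ?_⟩
  rw [map_zero]
  refine hU.eq_zero_of_ores (Y.basicOpen_le f) inf_le_left
    (⟨hηf, hηW⟩ : η ∈ Y.basicOpen f ⊓ W) ?_
  rw [ores_ores, ← ores_ores h inf_le_right, ha, map_zero]

omit hY in
-- On a basic open `D(b) ⊆ W` of the chart, `s = a / b ^ n`. A height-one prime not containing `h`
-- is a point of `W`, where `s` is regular. Hence `b ^ n` divides `h ^ m * a` for some `m`, and the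
-- quotient `c` gives the extension `c / h ^ m`.
lemma exists_extension_basicOpen {U : Y.Opens} (hU : IsAffineOpen U) (hK : IsKrullDomain Γ(Y, U))
    (h : Γ(Y, U)) {W : Y.Opens} (hW : W ≤ Y.basicOpen h)
    (hz : ∀ z ∈ Y.basicOpen h, z ∉ W → 2 ≤ Order.coheight z) (s : Γ(Y, W)) :
    ∃ t, ores hW t = s := by
  have := hK.isDomain
  have hWU := hW.trans (Y.basicOpen_le h)
  by_cases h0 : h = 0
  · refine ⟨0, eq_of_locally_fun fun x hx ↦ ?_⟩
    exact (IsAffineOpen.ne_zero_of_mem (hW hx) h0).elim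
  obtain ⟨η, hη0, hη⟩ := hU.exists_generic
  have mem (z : Y) (hz1 : Order.coheight z ≤ 1) (hzh : z ∈ Y.basicOpen h) : z ∈ W := by
    by_contra h'
    exact absurd ((hz z hzh h').trans hz1) (by decide)
  have hηW : η ∈ W := mem η (hη0.trans_le zero_le_one) (hη h h0)
  obtain ⟨b, hb, hηb⟩ := hU.exists_mem_basicOpen_le (hWU hηW) hηW
  have hb0 : b ≠ 0 := IsAffineOpen.ne_zero_of_mem hηb
  obtain ⟨n, a, ha⟩ := hU.exists_pow_mul_eq b (Y.basicOpen_le b) rfl (ores hb s)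
  obtain ⟨m, hm⟩ := hK.exists_dvd_pow_mul (pow_ne_zero n hb0) h
  -- Near the point of `q` one has `s = a' / k ^ j` with `k ∉ q`. Comparing with `a / b ^ n` at the
  -- generic point gives `a * k ^ j = b ^ n * a'`.
  obtain ⟨c, hc⟩ := hm a fun q hq hq1 _ hhq ↦ by
    obtain ⟨z, hz⟩ := hU.exists_primeIdealOf_eq q
    have hzW : z.1 ∈ W := by
      refine mem z ?_ ((hU.mem_basicOpen_iff z h).2 (by rwa [hz]))
      rw [← hU.height_primeIdealOf, hz, hq1]
    obtain ⟨k, hk, hzk⟩ := hU.exists_mem_basicOpen_le z.2 hzW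
    obtain ⟨j, a', ha'⟩ := hU.exists_pow_mul_eq k (Y.basicOpen_le k) rfl (ores hk s)
    refine ⟨k ^ j, fun hkq ↦ ?_, a', ?_⟩
    · rw [hU.mem_basicOpen_iff, hz] at hzk
      exact hzk (hq.mem_of_pow_mem _ hkq)
    · refine hU.eq_of_ores le_rfl (inf_le_left.trans (Y.basicOpen_le b))
        (⟨hηb, hη k (IsAffineOpen.ne_zero_of_mem hzk)⟩ : η ∈ Y.basicOpen b ⊓ Y.basicOpen k) ?_
      have e1 := congrArg (ores (inf_le_left : Y.basicOpen b ⊓ Y.basicOpen k ≤ _)) ha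
      have e2 := congrArg (ores (inf_le_right : Y.basicOpen b ⊓ Y.basicOpen k ≤ _)) ha'
      simp only [map_mul, map_pow, ores_ores] at e1 e2 ⊢
      rw [e1, e2]
      ring
  have hu : IsUnit (ores (Y.basicOpen_le h) h) := IsAffineOpen.isUnit_ores h _ le_rfl
  obtain ⟨v, hv⟩ := hu.pow m
  refine ⟨ores (Y.basicOpen_le h) c * ↑v⁻¹, hU.eq_of_ores hWU hb hηb ?_⟩
  have hub : IsUnit (ores (Y.basicOpen_le b) b ^ n) := (IsAffineOpen.isUnit_ores b _ le_rfl).pow n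
  have huh := ((hu.pow m).map (ores (hb.trans hW)))
  refine (huh.mul hub).mul_left_cancel ?_
  have e3 : ores (hb.trans hW) (ores (Y.basicOpen_le h) h ^ m) *
      ores (hb.trans hW) (↑v⁻¹) = 1 := by
    rw [← map_mul, ← hv, Units.mul_inv, map_one]
  have e4 := congrArg (ores (Y.basicOpen_le b)) hc
  rw [map_mul, ores_ores, ← ores_ores (Y.basicOpen_le h) (hb.trans hW)]
  simp only [map_mul, map_pow, ores_ores] at e3 e4 ha ⊢
  rw [ha] at e4
  linear_combination e3 * (ores (Y.basicOpen_le b) b ^ n * ores (Y.basicOpen_le b) c) - e4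

/-- Functions on a locally Krull scheme extend uniquely in codimension two. -/
lemma extendsInCodimTwo_unit : ExtendsInCodimTwo (unitM Y) := by
  intro V W h hz
  refine ⟨hY.ores_injective h hz, fun (s : Γ(Y, W)) ↦ ?_⟩
  have key (x : V) : ∃ U : Y.Opens, x.1 ∈ U ∧ U ≤ V ∧
      ∃ t : Γ(Y, U), ores (inf_le_left : U ⊓ W ≤ U) t = ores inf_le_right s := by
    obtain ⟨U, hU, hK, f, hxf, hf⟩ := hY.exists_basicOpen x.2
    exact ⟨_, hxf, hf, exists_extension_basicOpen hU hK f inf_le_left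
      (fun z hzf hzW ↦ hz z (hf hzf) fun h' ↦ hzW ⟨hzf, h'⟩) _⟩
  choose U hxU hUV t ht using key
  obtain ⟨r, hr⟩ := exists_glue (unitM Y) U t fun x y ↦ by
    refine hY.ores_injective (inf_le_left : (U x ⊓ U y) ⊓ W ≤ _)
      (fun z hzU hzW ↦ hz z (hUV x hzU.1) fun h' ↦ hzW ⟨hzU, h'⟩) ?_
    have e1 := congrArg (ores (inf_le_inf_right W inf_le_left : (U x ⊓ U y) ⊓ W ≤ U x ⊓ W)) (ht x)
    have e2 := congrArg (ores (inf_le_inf_right W inf_le_right : (U x ⊓ U y) ⊓ W ≤ U y ⊓ W)) (ht y)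
    rw [ores_ores, ores_ores] at e1 e2
    exact (ores_ores _ _ _).trans (e1.trans (e2.symm.trans (ores_ores _ _ _).symm))
  have hV : V ≤ iSup U := fun x hx ↦ Opens.mem_iSup.2 ⟨⟨x, hx⟩, hxU _⟩
  refine ⟨ores hV r, eq_of_locally_fun fun x hx ↦
    ⟨U ⟨x, h hx⟩ ⊓ W, inf_le_right, ⟨hxU _, hx⟩, ?_⟩⟩
  have e1 := congrArg (ores (inf_le_left : U ⟨x, h hx⟩ ⊓ W ≤ _)) (hr ⟨x, h hx⟩)
  rw [ht] at e1
  refine Eq.trans ?_ e1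
  exact (ores_ores _ _ _).trans ((ores_ores _ _ _).trans (ores_ores _ _ _).symm)

/-- A nonzero function vanishes at only finitely many points of codimension one. -/
lemma finite_vanishing {V : Y.Opens} (hV : IsAffineOpen V) [IsDomain Γ(Y, V)] {b : Γ(Y, V)}
    (hb : b ≠ 0) : {x : Y | x ∈ V ∧ Order.coheight x = 1 ∧ x ∉ Y.basicOpen b}.Finite := by
  have key (x : Y) (hx : x ∈ V) : ∃ W : Y.Opens, x ∈ W ∧
      {x : Y | x ∈ W ∧ Order.coheight x = 1 ∧ x ∉ Y.basicOpen b}.Finite := by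
    obtain ⟨U, hU, hK, h, hxh, hh⟩ := hY.exists_basicOpen hx
    -- On `D(h)` the zeros of `b` are those of its numerator `c` in the Krull chart, to which the
    -- finiteness axiom applies. Quasi-compactness of `V` then leaves finitely many such
    -- neighbourhoods.
    obtain ⟨n, c, hc⟩ := hU.exists_pow_mul_eq h (Y.basicOpen_le h) rfl (ores hh b)
    have hu := (IsAffineOpen.isUnit_ores h (Y.basicOpen_le h) le_rfl).pow n
    have hc0 : c ≠ 0 := by
      rintro rfl
      rw [map_zero, eq_comm, hu.mul_right_eq_zero] at hc
      exact hV.ores_ne_zero hh hxh hb hc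
    refine ⟨_, hxh, ((hK.finite c hc0).preimage
      (f := fun x : U ↦ (hU.primeIdealOf x).asIdeal) fun x _ y _ hxy ↦
        hU.primeIdealOf_injective (PrimeSpectrum.ext hxy)).image Subtype.val |>.subset ?_⟩
    rintro z ⟨hzh, hz1, hzb⟩
    have hzU := Y.basicOpen_le h hzh
    refine ⟨⟨z, hzU⟩, ⟨inferInstance, ?_, ?_⟩, rfl⟩
    · rw [hU.height_primeIdealOf]; exact hz1
    · by_contra hzc
      rw [← hU.mem_basicOpen_iff] at hzc
      have e1 : Y.basicOpen (ores (Y.basicOpen_le h) c) = Y.basicOpen h ⊓ Y.basicOpen c :=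
        Y.basicOpen_res _ _
      have e2 : Y.basicOpen (ores hh b) = Y.basicOpen h ⊓ Y.basicOpen b :=
        Y.basicOpen_res _ _
      have : z ∈ Y.basicOpen (ores (Y.basicOpen_le h) c) := e1 ▸ ⟨hzh, hzc⟩
      rw [hc, Y.basicOpen_mul, e2] at this
      exact hzb this.2.2
  let S := {x : Y | Order.coheight x = 1 ∧ x ∉ Y.basicOpen b}
  refine hV.isCompact.induction_on (p := fun s ↦ (s ∩ S).Finite) (by simp)
    (fun s t hst ht ↦ ht.subset (Set.inter_subset_inter_left _ hst))
    (fun s t hs ht ↦ by rw [Set.union_inter_distrib_right]; exact hs.union ht) fun x hx ↦ ?_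
  obtain ⟨W, hxW, hW⟩ := key x hx
  exact ⟨W, mem_nhdsWithin_of_mem_nhds (W.2.mem_nhds hxW), hW⟩

end Scheme.IsLocallyKrull

end AlgebraicGeometry

namespace AlgebraicGeometry

open Scheme Modules

variable {Y : Scheme.{u}}

namespace Scheme.Modules

/-! ### Quasi-coherent sheaves and localization of sections -/

/-- The sections of `M` over `V` localize to those over the basic open subsets of `V`. -/
structure IsLocalizingOn (M : Y.Modules) (V : Y.Opens) : Prop where
  exists_extension (f : Γ(Y, V)) (s : Γ(M, Y.basicOpen f)) :
    ∃ n, ∃ t : Γ(M, V), mres M (Y.basicOpen_le f) t = ores (Y.basicOpen_le f) f ^ n • s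
  exists_pow_smul_eq_zero (f : Γ(Y, V)) (t : Γ(M, V)) (h : mres M (Y.basicOpen_le f) t = 0) :
    ∃ n, f ^ n • t = 0

variable {M : Y.Modules} {V : Y.Opens} (hV : IsAffineOpen V)

/-- Identifies the scalar action of the ring on the sheaf pulled back to its spectrum with
multiplication by restricted functions on `Y`. -/
lemma appIso_inv_fromSpec (U : (Spec Γ(Y, V)).Opens) (h : hV.fromSpec ''ᵁ U ≤ V) (r : Γ(Y, V)) :
    (hV.fromSpec.appIso U).inv ((Spec Γ(Y, V)).presheaf.map U.leTop.op
      ((Scheme.ΓSpecIso Γ(Y, V)).inv r)) = ores h r := by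
  have : (Scheme.ΓSpecIso Γ(Y, V)).inv ≫ (Spec Γ(Y, V)).presheaf.map U.leTop.op ≫
      (hV.fromSpec.appIso U).inv = Y.presheaf.map (homOfLE h).op := by
    rw [← Category.assoc, Iso.comp_inv_eq, Scheme.Hom.appIso_hom', Scheme.Hom.map_appLE]
    have h1 : U ≤ hV.fromSpec ⁻¹ᵁ V := by rw [hV.fromSpec_preimage_self]; exact le_top
    change _ = hV.fromSpec.appLE V U h1
    rw [Scheme.Hom.appLE, hV.fromSpec_app_self, Category.assoc, ← Functor.map_comp]
    rfl
  exact ConcreteCategory.congr_hom this r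

lemma image_fromSpec_le (U : (Spec Γ(Y, V)).Opens) : hV.fromSpec ''ᵁ U ≤ V :=
  (hV.fromSpec.image_le_opensRange U).trans hV.opensRange_fromSpec.le

lemma le_image_fromSpec_top : V ≤ hV.fromSpec ''ᵁ ⊤ := by
  rw [Scheme.Hom.image_top_eq_opensRange, hV.opensRange_fromSpec]

/-- Transports an equation between two opens `A` and `W` that coincide but not definitionally, such
as `D(f)` and the image of the corresponding basic open of the spectrum. -/
lemma mres_mres_of_eq_smul {A B V W : Y.Opens} {hAB : A ≤ B} {hAW : A ≤ W} (hWA : W ≤ A)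
    {hWV : W ≤ V} {hVB : V ≤ B} {hAV : A ≤ V} {t : Γ(M, B)} {s : Γ(M, W)} {a : Γ(Y, V)}
    (h : mres M hAB t = ores hAV a • mres M hAW s) :
    mres M hWV (mres M hVB t) = ores hWV a • s := by
  have := congrArg (mres M hWA) h
  rw [mres_smul, mres_mres, mres_mres, mres_self, ores_ores] at this
  rw [mres_mres, this]

/-- Restates the criterion for being the sheaf associated with a module on an affine scheme in terms
of sections and restriction maps on `Y`. -/
lemma isLocalizing_iff : IsLocalizing (modulesSpecToSheaf.obj (M.restrict hV.fromSpec)) ↔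
    IsLocalizingOn M V := by
  have hsmul (U : (Spec Γ(Y, V)).Opens) (r : Γ(Y, V)) (s : Γ(M.restrict hV.fromSpec, U)) :
      r • s = (HSMul.hSMul (β := Γ(M, hV.fromSpec ''ᵁ U)) (ores (image_fromSpec_le hV U) r) s :
        Γ(M, hV.fromSpec ''ᵁ U)) :=
    congrArg (fun a ↦ HSMul.hSMul (β := Γ(M, hV.fromSpec ''ᵁ U)) a s)
      (appIso_inv_fromSpec hV U (image_fromSpec_le hV U) r)
  have hle1 := le_image_fromSpec_top hV
  have hle2 := image_fromSpec_le hV ⊤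
  have hf1 (f : Γ(Y, V)) : hV.fromSpec ''ᵁ (PrimeSpectrum.basicOpen f) ≤ Y.basicOpen f :=
    (hV.fromSpec_image_basicOpen f).le
  have hf2 (f : Γ(Y, V)) : Y.basicOpen f ≤ hV.fromSpec ''ᵁ (PrimeSpectrum.basicOpen f) :=
    (hV.fromSpec_image_basicOpen f).ge
  have hle (f : Γ(Y, V)) : hV.fromSpec ''ᵁ (PrimeSpectrum.basicOpen f) ≤ hV.fromSpec ''ᵁ ⊤ :=
    hV.fromSpec.image_mono le_top
  refine ⟨fun h ↦ ⟨fun f s ↦ ?_, fun f t ht ↦ ?_⟩, fun h f ↦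
    IsLocalizedModule.Away.mk_of_addCommGroup
      (isUnit_algebraMap_end_of_le_basicOpen (M := M.restrict hV.fromSpec) f le_rfl)
      (fun (s : Γ(M, hV.fromSpec ''ᵁ (PrimeSpectrum.basicOpen f))) ↦ ?_)
      (fun (t : Γ(M, hV.fromSpec ''ᵁ ⊤)) (ht : mres M (hle f) t = 0) ↦ ?_)⟩
  · obtain ⟨⟨t, _, n, rfl⟩, ht⟩ := (h f).surj (mres M (hf1 f) s)
    have ht' : mres M (hle f) t = ores (image_fromSpec_le hV _) (f ^ n) • mres M (hf1 f) s :=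
      ht.symm.trans (hsmul _ _ _)
    refine ⟨n, mres M hle1 t, ?_⟩
    exact (mres_mres_of_eq_smul (hf2 f) ht').trans (congrArg (· • s) (map_pow _ f n))
  · have h0 : mres M (hle f) (mres M hle2 t) = 0 :=
      (mres_mres M hle2 (hle f) t).trans ((mres_mres M (Y.basicOpen_le f) (hf1 f) t).symm.trans
        ((congrArg _ ht).trans (map_zero _)))
    obtain ⟨⟨_, n, rfl⟩, hc⟩ := (@IsLocalizedModule.eq_zero_iff _ _ (Submonoid.powers f) _ _ _ _ _ _ _ (h f)
      (mres M hle2 t)).1 h0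
    have hc' : ores hle2 (f ^ n) • mres M hle2 t = 0 := (hsmul ⊤ (f ^ n) (mres M hle2 t)).symm.trans hc
    refine ⟨n, ?_⟩
    have := congrArg (mres M hle1) hc'
    rwa [mres_smul, mres_mres, ores_ores, mres_self, ores_self, map_zero] at this
  · obtain ⟨n, t, ht⟩ := h.exists_extension f (mres M (hf2 f) s)
    refine ⟨n, mres M hle2 t, (hsmul _ _ _).trans ?_⟩
    refine Eq.trans ?_ (mres_mres_of_eq_smul (V := V) (hVB := le_rfl) (hWV := image_fromSpec_le hV _)
      (a := f ^ n) (s := s) (t := t) (hAW := hf2 f) (hAB := Y.basicOpen_le f) (hf1 f)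
      (ht.trans (congrArg (fun a : Γ(Y, Y.basicOpen f) ↦ a • mres M (hf2 f) s)
        (map_pow _ f n).symm))).symm |>.trans ?_
    · rfl
    · exact (mres_mres M le_rfl _ t).trans (mres_mres M hle2 (hle f) t).symm
  · have h0 : mres M (Y.basicOpen_le f) (mres M hle1 t) = 0 :=
      (mres_mres M hle1 (Y.basicOpen_le f) t).trans ((mres_mres M (hle f) (hf2 f) t).symm.trans
        ((congrArg _ ht).trans (map_zero _)))
    obtain ⟨n, hn⟩ := h.exists_pow_smul_eq_zero f (mres M hle1 t) h0
    refine ⟨n, (hsmul _ _ _).trans ?_⟩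
    have := congrArg (mres M hle2) hn
    rwa [mres_smul, mres_mres, mres_self, map_zero] at this

/-- Transport of a presentation along an isomorphism. -/
def presentationOfIso {X : Scheme.{u}} {M N : X.Modules} (e : M ≅ N)
    (p : SheafOfModules.Presentation.{u, u, u} M) : SheafOfModules.Presentation.{u, u, u} N :=
  @SheafOfModules.Presentation.ofIsIso _ _ _ _ _ _ M N e.hom
    (inferInstanceAs (IsIso (C := X.Modules) e.hom)) p

include hV

lemma isLocalizingOn_of_isQuasicoherent (hM : SheafOfModules.IsQuasicoherent.{u, u, u} M) :
    IsLocalizingOn M V := by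
  have : SheafOfModules.IsQuasicoherent.{u, u, u} (M.restrict hV.fromSpec) :=
    @isQuasicoherent_restrictFunctor _ _ hV.fromSpec _ M hM
  rw [← isLocalizing_iff hV, ← isIso_fromTildeΓ_iff_isLocalizing]
  infer_instance

lemma exists_presentation_restrict (h : IsLocalizingOn M V) :
    Nonempty (SheafOfModules.Presentation.{u, u, u} (M.restrict hV.fromSpec)) := by
  have := (isIso_fromTildeΓ_iff_isLocalizing _).2 ((isLocalizing_iff hV).2 h)
  exact ⟨presentationOfIso (@asIso (Spec Γ(Y, V)).Modules _ _ _ _ this)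
    (presentationTilde _ Set.univ (by simp) _ (Submodule.span_eq _))⟩

/-- Quasi-coherence is defined by presentations on the slice site over `V`, so the presentation on
the spectrum is carried along `V.toScheme ≅ Spec Γ(Y, V)` and then through the equivalence with that
slice. -/
lemma exists_presentation_over (h : IsLocalizingOn M V) :
    Nonempty (SheafOfModules.Presentation.{u, u, u} (SheafOfModules.over M V)) := by
  obtain ⟨p⟩ := exists_presentation_restrict hV h
  have : hV.isoSpec.hom ≫ hV.fromSpec = V.ι := by
    rw [← Iso.eq_inv_comp]
    exact hV.isoSpec_inv_ι.symm
  let e : (M.restrict hV.fromSpec).restrict hV.isoSpec.hom ≅ M.restrict V.ι :=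
    ((restrictFunctorComp hV.isoSpec.hom hV.fromSpec).app M).symm ≪≫
      (restrictFunctorCongr this).app M
  let e' : (overEquiv V).inverse.obj (M.restrict V.ι) ≅ SheafOfModules.over M V :=
    (overEquiv V).inverse.mapIso ((overFunctorEquiv V).app M).symm ≪≫
      ((overEquiv V).unitIso.app (SheafOfModules.over M V)).symm
  let E : SheafOfModules.{u} V.toScheme.ringCatSheaf ⥤ SheafOfModules.{u} (Y.ringCatSheaf.over V) :=
    (TopologicalSpace.Opens.sheafOfModulesEquivOver V Y.ringCatSheaf).inverse
  have : E.IsEquivalence :=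
    (TopologicalSpace.Opens.sheafOfModulesEquivOver V Y.ringCatSheaf).isEquivalence_inverse
  have : Limits.PreservesColimitsOfSize.{u, u} E := inferInstance
  let p' := SheafOfModules.Presentation.map (M := M.restrict V.ι)
    (presentationOfIso e (presentationRestrict hV.isoSpec.hom p)) E
    (TopologicalSpace.Opens.sheafOfModulesEquivOverInverseUnit _ _).symm
  exact ⟨SheafOfModules.Presentation.ofIsIso.{u, u, u} e'.hom p'⟩

omit hV in
lemma isQuasicoherent_of_isLocalizingOn (h : ∀ x : Y, ∃ V : Y.Opens, x ∈ V ∧ IsAffineOpen V ∧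
    IsLocalizingOn M V) : SheafOfModules.IsQuasicoherent.{u, u, u} M := by
  choose V hxV hV hM using h
  let q : SheafOfModules.QuasicoherentData.{u, u, u, u} M :=
    { I := Y
      X := V
      coversTop := by
        rw [Opens.coversTop_iff, IsOpenCover, eq_top_iff]
        exact fun x _ ↦ Opens.mem_iSup.2 ⟨x, hxV x⟩
      presentation := fun x ↦ (exists_presentation_over (hV x) (hM x)).some }
  exact q.isQuasicoherent

end Scheme.Modules

end AlgebraicGeometry

namespace AlgebraicGeometry

open Scheme Modules

variable {Y : Scheme.{u}}

namespace Scheme.Modules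

/-! ### Sheaves invertible in codimension one -/

/-- The basic open sets of the nonzero functions `c i` cover `V` up to codimension two. -/
structure IsBigCover {V : Y.Opens} {ι : Type u} (c : ι → Γ(Y, V)) : Prop where
  ne_zero (i : ι) : c i ≠ 0
  two_le_coheight (z : Y) (hz : z ∈ V) (h : ∀ i, z ∉ Y.basicOpen (c i)) : 2 ≤ Order.coheight z

variable {F : Y.Modules} {V : Y.Opens} {ι : Type u} {c : ι → Γ(Y, V)}

lemma IsBigCover.eq_of_mres (hc : IsBigCover c) (hF : ExtendsInCodimTwo F) {W : Y.Opens}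
    (hW : W ≤ V) {s t : Γ(F, W)} (h : ∀ i, mres F (inf_le_left : W ⊓ Y.basicOpen (c i) ≤ W) s =
      mres F (inf_le_left : W ⊓ Y.basicOpen (c i) ≤ W) t) : s = t := by
  have hle : ⨆ i, W ⊓ Y.basicOpen (c i) ≤ W := iSup_le fun i ↦ inf_le_left
  refine (hF W _ hle fun z hz hz' ↦ hc.two_le_coheight z (hW hz) fun i hi ↦ hz' ?_).1 ?_
  · exact Opens.mem_iSup.2 ⟨i, hz, hi⟩
  · refine eq_of_locally F fun x hx ↦ ?_
    obtain ⟨i, hi⟩ := Opens.mem_iSup.1 hx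
    refine ⟨_, le_iSup (fun i ↦ W ⊓ Y.basicOpen (c i)) i, hi, ?_⟩
    rw [mres_mres, mres_mres, h]

/-- The `t i` agree on overlaps because they all agree with `s` on a nonempty open and, by `hT`,
there is no room for a difference. They glue outside codimension two and the glued section extends
to `V`. The hypothesis `hT` is stated abstractly so that `F` may also be the structure sheaf. -/
lemma IsBigCover.exists_extension (hV : IsAffineOpen V) [IsDomain Γ(Y, V)] (hc : IsBigCover c)
    (hF : ExtendsInCodimTwo F)
    (hT : ∀ (i : ι) (W W' : Y.Opens) (h : W' ≤ W) (z : Y) (s : Γ(F, W)), W ≤ Y.basicOpen (c i) →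
      z ∈ W' → mres F h s = 0 → s = 0)
    {f : Γ(Y, V)} (hf : f ≠ 0) (s : Γ(F, Y.basicOpen f)) (t : ∀ i, Γ(F, Y.basicOpen (c i)))
    (hst : ∀ i, mres F (inf_le_left : Y.basicOpen (c i) ⊓ Y.basicOpen f ≤ _) (t i) =
      mres F inf_le_right s) : ∃ r : Γ(F, V), mres F (Y.basicOpen_le f) r = s := by
  obtain ⟨η, -, hη⟩ := hV.exists_generic
  obtain ⟨r₀, hr₀⟩ := exists_glue F (fun i ↦ Y.basicOpen (c i)) t fun i j ↦ by
    refine sub_eq_zero.1 (hT i _ ((Y.basicOpen (c i) ⊓ Y.basicOpen (c j)) ⊓ Y.basicOpen f)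
      inf_le_left η _ inf_le_left
      ⟨⟨hη _ (hc.ne_zero i), hη _ (hc.ne_zero j)⟩, hη f hf⟩ ?_)
    have e1 := congrArg (mres F (inf_le_inf_right (Y.basicOpen f) inf_le_left :
      (Y.basicOpen (c i) ⊓ Y.basicOpen (c j)) ⊓ Y.basicOpen f ≤ _)) (hst i)
    have e2 := congrArg (mres F (inf_le_inf_right (Y.basicOpen f) inf_le_right :
      (Y.basicOpen (c i) ⊓ Y.basicOpen (c j)) ⊓ Y.basicOpen f ≤ _)) (hst j)
    rw [mres_mres, mres_mres] at e1 e2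
    rw [map_sub, mres_mres, mres_mres, e1, e2, sub_self]
  have hle : ⨆ i, Y.basicOpen (c i) ≤ V := iSup_le fun i ↦ Y.basicOpen_le _
  obtain ⟨r, hr⟩ := (hF V _ hle fun z hz hz' ↦ hc.two_le_coheight z hz fun i hi ↦ hz'
    (Opens.mem_iSup.2 ⟨i, hi⟩)).2 r₀
  refine ⟨r, hc.eq_of_mres hF (Y.basicOpen_le f) fun i ↦ ?_⟩
  have e1 := congrArg (mres F (inf_le_left : Y.basicOpen (c i) ⊓ Y.basicOpen f ≤ _)) (hr₀ i)
  rw [hst, ← hr, mres_mres, mres_mres] at e1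
  have e2 := congrArg (mres F (inf_comm _ _).le :
    Γ(F, Y.basicOpen (c i) ⊓ Y.basicOpen f) → Γ(F, Y.basicOpen f ⊓ Y.basicOpen (c i))) e1
  rw [mres_mres, mres_mres] at e2
  rw [mres_mres, e2]

lemma IsGen.eq_zero_of_mres (hV : IsAffineOpen V) [IsDomain Γ(Y, V)] {D : Y.Opens} (hD : D ≤ V)
    {g : Γ(F, D)} (hg : IsGen F.val D g) {W W' : Y.Opens} (hW : W ≤ D) (h : W' ≤ W) {z : Y}
    (hz : z ∈ W') {s : Γ(F, W)} (hs : Modules.mres F h s = 0) : s = 0 := by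
  obtain ⟨e, rfl⟩ := hg.exists_smul_eq hW s
  have : ores h e = 0 := by
    refine hg.smul_injective (h.trans hW) ?_
    rw [mres_smul, mres_mres] at hs
    rw [hs, zero_smul]
  rw [hV.eq_zero_of_ores (hW.trans hD) h hz this, zero_smul]

lemma smul_eq_zero_iff_of_isUnit {W : Y.Opens} {a : Γ(Y, W)} (ha : IsUnit a) {s : Γ(F, W)} :
    a • s = 0 ↔ s = 0 := by
  obtain ⟨a, rfl⟩ := ha
  exact smul_eq_zero_iff_eq a

section

variable (hV : IsAffineOpen V) [IsDomain Γ(Y, V)] (hc : IsBigCover c) (hF : ExtendsInCodimTwo F)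
  {g : ∀ i, Γ(F, Y.basicOpen (c i))} (hg : ∀ i, IsGen F.val (Y.basicOpen (c i)) (g i))

include hV hc hF hg

lemma IsBigCover.eq_zero_of_mres {f : Γ(Y, V)} (hf : f ≠ 0) {s : Γ(F, V)}
    (hs : mres F (Y.basicOpen_le f) s = 0) : s = 0 := by
  obtain ⟨η, -, hη⟩ := hV.exists_generic
  refine hc.eq_of_mres hF le_rfl fun i ↦ ?_
  rw [map_zero]
  refine (hg i).eq_zero_of_mres hV (Y.basicOpen_le _) inf_le_right
    (W' := (V ⊓ Y.basicOpen (c i)) ⊓ Y.basicOpen f) inf_le_left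
    ⟨⟨Y.basicOpen_le f (hη f hf), hη _ (hc.ne_zero i)⟩, hη f hf⟩ ?_
  rw [mres_mres, ← mres_mres F (Y.basicOpen_le f) inf_le_right, hs, map_zero]

lemma IsBigCover.eq_zero_of_smul {a : Γ(Y, V)} (ha : a ≠ 0) {s : Γ(F, V)}
    (hs : a • s = 0) : s = 0 := by
  refine hc.eq_zero_of_mres hV hF hg ha ?_
  have := congrArg (mres F (Y.basicOpen_le a)) hs
  rwa [mres_smul, map_zero, smul_eq_zero_iff_of_isUnit (IsAffineOpen.isUnit_ores a _ le_rfl)]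
    at this

/-- On each `D(c i)` the sheaf is free, so some power of `f` clears the pole of `s` there. The cover
being finite, one power serves for all `i`, and the cleared sections extend over `V`. -/
lemma IsBigCover.isLocalizingOn [Finite ι] : IsLocalizingOn F V := by
  refine ⟨fun f s ↦ ?_, fun f t ht ↦ ?_⟩
  · by_cases hf : f = 0
    -- For `f = 0` the open `D(f)` is empty, so any two sections over it coincide.
    · exact ⟨0, 0, eq_of_locally F fun x hx ↦ (IsAffineOpen.ne_zero_of_mem hx hf).elim⟩
    have key (i) : ∃ n, ∃ d : Γ(Y, Y.basicOpen (c i)),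
        mres F (inf_le_left : Y.basicOpen (c i) ⊓ Y.basicOpen f ≤ _) (d • g i) =
          ores (inf_le_left.trans (Y.basicOpen_le (c i)) : Y.basicOpen (c i) ⊓ Y.basicOpen f ≤ V)
            f ^ n • mres F (inf_le_right : Y.basicOpen (c i) ⊓ Y.basicOpen f ≤ _) s := by
      obtain ⟨e, he⟩ := (hg i).exists_smul_eq
        (inf_le_left : Y.basicOpen (c i) ⊓ Y.basicOpen f ≤ _) (mres F inf_le_right s)
      obtain ⟨n, d, hd⟩ := (hV.basicOpen (c i)).exists_pow_mul_eq (ores (Y.basicOpen_le _) f)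
        (inf_le_left : Y.basicOpen (c i) ⊓ Y.basicOpen f ≤ _) (Y.basicOpen_res _ _).symm e
      refine ⟨n, d, ?_⟩
      rw [mres_smul, hd, mul_smul, he, ores_ores]
    choose n d hd using key
    obtain ⟨m, hm⟩ := (Set.finite_range n).bddAbove
    refine ⟨m, hc.exists_extension hV hF (fun i W W' h z s hW hz ↦
      (hg i).eq_zero_of_mres hV (Y.basicOpen_le _) hW h hz) hf _
      (fun i ↦ ores (Y.basicOpen_le (c i)) f ^ (m - n i) • d i • g i) fun i ↦ ?_⟩
    rw [mres_smul, hd, mres_smul, map_pow, map_pow, ores_ores, ores_ores, ← mul_smul, ← pow_add,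
      Nat.sub_add_cancel (hm ⟨i, rfl⟩)]
  · by_cases hf : f = 0
    · exact ⟨1, by rw [hf, pow_one, zero_smul]⟩
    · exact ⟨0, by rw [pow_zero, one_smul, hc.eq_zero_of_mres hV hF hg hf ht]⟩

omit hF in
-- On `D(c i)` a power of `c i₀` turns `g i` into a regular multiple `w i` of `g i₀`. With `N` the
-- largest exponent, the coefficient of `c i₀ ^ N • s` along `g i₀` is regular on every `D(c i)`,
-- hence extends to `V`. The bound `N` is independent of `s`.
lemma IsBigCover.exists_denominator [Finite ι] (hY : ExtendsInCodimTwo (unitM Y)) (i₀ : ι) :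
    ∃ N, ∀ s : Γ(F, V), ∃ α : Γ(Y, V), ores (Y.basicOpen_le (c i₀)) α • g i₀ =
      ores (Y.basicOpen_le (c i₀)) (c i₀) ^ N • mres F (Y.basicOpen_le (c i₀)) s := by
  have key (i) : ∃ n, ∃ w : Γ(Y, Y.basicOpen (c i)),
      ores (inf_le_left : Y.basicOpen (c i) ⊓ Y.basicOpen (c i₀) ≤ _) w •
          mres F (inf_le_right : Y.basicOpen (c i) ⊓ Y.basicOpen (c i₀) ≤ _) (g i₀) =
        ores (inf_le_left.trans (Y.basicOpen_le (c i)) :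
          Y.basicOpen (c i) ⊓ Y.basicOpen (c i₀) ≤ V) (c i₀) ^ n •
          mres F (inf_le_left : Y.basicOpen (c i) ⊓ Y.basicOpen (c i₀) ≤ _) (g i) := by
    obtain ⟨v, hv⟩ := (hg i₀).exists_smul_eq
      (inf_le_right : Y.basicOpen (c i) ⊓ Y.basicOpen (c i₀) ≤ _) (mres F inf_le_left (g i))
    obtain ⟨n, w, hw⟩ := (hV.basicOpen (c i)).exists_pow_mul_eq (ores (Y.basicOpen_le _) (c i₀))
      (inf_le_left : Y.basicOpen (c i) ⊓ Y.basicOpen (c i₀) ≤ _) (Y.basicOpen_res _ _).symm v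
    exact ⟨n, w, by rw [hw, mul_smul, hv, ores_ores]⟩
  choose n w hw using key
  obtain ⟨N, hN⟩ := (Set.finite_range n).bddAbove
  refine ⟨N, fun s ↦ ?_⟩
  obtain ⟨a, ha⟩ := (hg i₀).exists_smul_eq le_rfl
    (ores (Y.basicOpen_le (c i₀)) (c i₀) ^ N • mres F (Y.basicOpen_le (c i₀)) s)
  rw [mres_self] at ha
  choose e he using fun i ↦ (hg i).exists_smul_eq le_rfl (mres F (Y.basicOpen_le _) s)
  obtain ⟨α, hα⟩ := hc.exists_extension (F := unitM Y) hV hY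
    (fun i W W' h z s hW hz ↦ hV.eq_zero_of_ores (hW.trans (Y.basicOpen_le _)) h hz)
    (hc.ne_zero i₀) a (fun i ↦ e i * (ores (Y.basicOpen_le _) (c i₀) ^ (N - n i) * w i))
    fun i ↦ by
      change ores (inf_le_left : Y.basicOpen (c i) ⊓ Y.basicOpen (c i₀) ≤ _)
        (e i * (ores (Y.basicOpen_le (c i)) (c i₀) ^ (N - n i) * w i)) = ores inf_le_right a
      refine (hg i₀).smul_injective inf_le_right ?_
      have h1 := congrArg (mres F (inf_le_right : Y.basicOpen (c i) ⊓ Y.basicOpen (c i₀) ≤ _)) ha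
      have h2 := congrArg (mres F (inf_le_left : Y.basicOpen (c i) ⊓ Y.basicOpen (c i₀) ≤ _)) (he i)
      rw [mres_self] at h2
      simp only [mres_smul, map_pow, map_mul, ores_ores, mres_mres] at h1 h2 ⊢
      rw [h1, mul_smul, mul_smul, hw, ← mul_smul (_ ^ _), ← pow_add,
        Nat.sub_add_cancel (hN ⟨i, rfl⟩), smul_comm, h2]
  have hα' : ores (Y.basicOpen_le _) α = a := hα
  exact ⟨α, by rw [hα', ha]⟩

/-- The coefficient `α` with the common denominator `c i₀ ^ N` is unique, so `s ↦ α` is linear. It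
is injective since `s` is determined on `D(c i₀)`, so the sections embed in the ring itself. -/
lemma IsBigCover.isModuleLattice [Finite ι] (hY : ExtendsInCodimTwo (unitM Y)) (i₀ : ι) :
    IsModuleLattice Γ(Y, V) Γ(F, V) := by
  obtain ⟨N, hN⟩ := hc.exists_denominator hV hg hY i₀
  obtain ⟨η, -, hη⟩ := hV.exists_generic
  choose φ hφ using hN
  have uniq {a b : Γ(Y, V)} (h : ores (Y.basicOpen_le (c i₀)) a • g i₀ =
      ores (Y.basicOpen_le (c i₀)) b • g i₀) : a = b := by
    refine hV.eq_of_ores le_rfl (Y.basicOpen_le (c i₀)) (hη _ (hc.ne_zero i₀)) ?_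
    refine (hg i₀).smul_injective le_rfl ?_
    rwa [mres_self]
  refine ⟨⟨fun a ha ↦ (injective_iff_map_eq_zero (AddMonoidHom.mk' (fun s : Γ(F, V) ↦ a • s)
    (smul_add a))).2 fun s hs ↦ hc.eq_zero_of_smul hV hF hg ha.ne_zero hs⟩,
    ModuleCat.of _ Γ(Y, V), Module.Finite.self _,
    { toFun := φ
      map_add' := fun s t ↦ uniq (by
        rw [hφ, map_add, map_add, add_smul, hφ, hφ, smul_add])
      map_smul' := fun a s ↦ uniq (by
        rw [hφ, RingHom.id_apply, smul_eq_mul, map_mul, mul_smul, hφ, mres_smul, smul_comm]) },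
    (injective_iff_map_eq_zero _).2 fun s hs ↦ ?_⟩
  refine hc.eq_zero_of_mres hV hF hg (hc.ne_zero i₀) ?_
  have h1 := hφ s
  have h2 : φ s = 0 := hs
  rwa [h2, map_zero, zero_smul, eq_comm, smul_eq_zero_iff_of_isUnit
    ((IsAffineOpen.isUnit_ores (c i₀) _ le_rfl).pow N)] at h1

end

lemma exists_isBigCover (hY : Y.IsLocallyKrull) (hV : IsAffineOpen V) [IsDomain Γ(Y, V)]
    (hgen : ∀ x : Y, Order.coheight x ≤ 1 → HasGenAt F x) :
    ∃ (ι : Type u) (c : ι → Γ(Y, V)), Finite ι ∧ Nonempty ι ∧ IsBigCover c ∧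
      ∃ g : ∀ i, Γ(F, Y.basicOpen (c i)), ∀ i, IsGen F.val (Y.basicOpen (c i)) (g i) := by
  have key (x : Y) (hx : x ∈ V) (h : Order.coheight x ≤ 1) : ∃ c : Γ(Y, V), x ∈ Y.basicOpen c ∧
      ∃ g : Γ(F, Y.basicOpen c), IsGen F.val (Y.basicOpen c) g := by
    obtain ⟨W, hxW, g, hg⟩ := hgen x h
    obtain ⟨c, hc, hxc⟩ := hV.exists_mem_basicOpen_le hx hxW
    exact ⟨c, hxc, _, hg.mres hc⟩
  obtain ⟨η, hη0, hη⟩ := hV.exists_generic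
  obtain ⟨b, hηb, gb, hgb⟩ := key η (Y.basicOpen_le 1 (hη 1 one_ne_zero)) (hη0.trans_le zero_le_one)
  have fin := (hY.finite_vanishing hV (IsAffineOpen.ne_zero_of_mem hηb)).to_subtype
  choose c hxc g hg using fun x : {x : Y | x ∈ V ∧ Order.coheight x = 1 ∧ x ∉ Y.basicOpen b} ↦
    key x.1 x.2.1 x.2.2.1.le
  -- The index `none` stands for a basic neighbourhood `D(b)` of the generic point, and the others
  -- for the finitely many codimension-one points outside it.
  refine ⟨Option {x : Y | x ∈ V ∧ Order.coheight x = 1 ∧ x ∉ Y.basicOpen b}, fun i ↦ i.elim b c,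
    inferInstance, inferInstance, ⟨?_, ?_⟩, fun i ↦ i.rec gb g, ?_⟩
  · rintro (_ | i)
    exacts [IsAffineOpen.ne_zero_of_mem hηb, IsAffineOpen.ne_zero_of_mem (hxc i)]
  · intro z hz h
    by_contra h2
    have h2 : Order.coheight z ≤ 1 := Order.le_of_lt_succ (not_le.1 h2)
    rcases h2.lt_or_eq with h3 | h3
    -- A point of codimension zero has prime ideal zero, so it lies in `D(b)`.
    · refine h none ((hV.mem_basicOpen_iff ⟨z, hz⟩ b).2 fun hb ↦ IsAffineOpen.ne_zero_of_mem hηb ?_)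
      have h4 := hV.height_primeIdealOf ⟨z, hz⟩
      rw [Order.lt_one_iff.1 h3, Ideal.height_eq_zero_iff_eq_bot] at h4
      rwa [h4] at hb
    · exact h (some ⟨z, hz, h3, h none⟩) (hxc _)
  · rintro (_ | i)
    exacts [hgb, hg i]

lemma HasGenAt.finrank_stalk {x : Y} (h : HasGenAt F x) :
    Module.finrank (Y.presheaf.stalk x) (F.presheaf.stalk x) = 1 := by
  obtain ⟨V, hxV, g, hg⟩ := h
  have hsmul (W : Y.Opens) (hW : x ∈ W) (a : Γ(Y, W)) (s : Γ(F, W)) :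
      F.presheaf.germ W x hW (a • s) = Y.presheaf.germ W x hW a • F.presheaf.germ W x hW s :=
    PresheafOfModules.germ_smul (R := Y.presheaf) F.val x W hW a s
  let φ := LinearMap.toSpanSingleton (Y.presheaf.stalk x) (F.presheaf.stalk x)
    (F.presheaf.germ V x hxV g)
  have hφ (W : Y.Opens) (hW : W ≤ V) (hx : x ∈ W) (a : Γ(Y, W)) :
      φ (Y.presheaf.germ W x hx a) = F.presheaf.germ W x hx (a • mres F hW g) := by
    rw [hsmul]
    exact congrArg (fun s : F.presheaf.stalk x ↦ Y.presheaf.germ W x hx a • s)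
      (TopCat.Presheaf.germ_res_apply F.presheaf (homOfLE hW) x hx g).symm
  have : Function.Bijective φ := by
    refine ⟨(injective_iff_map_eq_zero φ).2 fun a ha ↦ ?_, fun s ↦ ?_⟩
    · obtain ⟨W, hW, hx, a, rfl⟩ := TopCat.Presheaf.exists_le_germ_eq Y.presheaf a hxV
      rw [hφ W hW] at ha
      obtain ⟨W', hx', i, i', h⟩ := TopCat.Presheaf.germ_eq F.presheaf x hx hx _ 0
        (ha.trans (map_zero _).symm)
      have h0 : mres F i.le (a • mres F hW g) = 0 := h.trans (map_zero _)
      rw [mres_smul, mres_mres] at h0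
      have h1 : ores i.le a = 0 := hg.smul_injective (i.le.trans hW) (by rw [h0, zero_smul])
      rw [← TopCat.Presheaf.germ_res_apply Y.presheaf i x hx' a]
      exact (congrArg _ h1).trans (map_zero _)
    · obtain ⟨W, hW, hx, s, rfl⟩ := TopCat.Presheaf.exists_le_germ_eq F.presheaf s hxV
      obtain ⟨a, rfl⟩ := hg.exists_smul_eq hW s
      exact ⟨_, hφ W hW hx a⟩
  rw [← (LinearEquiv.ofBijective φ this).finrank_eq, Module.finrank_self]

/-- A sheaf on a locally Krull scheme whose sections extend uniquely in codimension two and which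
is invertible in codimension one is a rank-one reflexive sheaf. -/
theorem isRankOneReflexive_of_extendsInCodimTwo (hY : Y.IsLocallyKrull) (hF : ExtendsInCodimTwo F)
    (hgen : ∀ x : Y, Order.coheight x ≤ 1 → HasGenAt F x) : IsRankOneReflexive F := by
  refine ⟨⟨⟨isQuasicoherent_of_isLocalizingOn fun x ↦ ?_, fun V hV hA ↦ ?_⟩,
    isIso_toBidual hY.extendsInCodimTwo_unit hF hgen⟩, fun ξ hξ ↦ (hgen ξ ?_).finrank_stalk⟩
  · obtain ⟨V, hxV, hV, hK⟩ := hY x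
    have := hK.isDomain
    obtain ⟨ι, c, _, -, hc, g, hg⟩ := exists_isBigCover hY hV hgen
    exact ⟨V, hxV, hV, hc.isLocalizingOn hV hF hg⟩
  · obtain ⟨ι, c, _, ⟨i₀⟩, hc, g, hg⟩ := exists_isBigCover hY hV hgen
    exact hc.isModuleLattice hV hF hg hY.extendsInCodimTwo_unit i₀
  · have h1 := ringKrullDim_stalk_eq_coheight ξ
    rw [ringKrullDim_eq_zero_of_isField hξ] at h1
    have h2 : Order.coheight ξ = 0 := by exact_mod_cast h1.symm
    rw [h2]
    exact zero_le_one

end Scheme.Modules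

end AlgebraicGeometry

namespace AlgebraicGeometry

open Scheme Modules

variable {Y : Scheme.{u}}

lemma _root_.IsField.exists_smul_eq_of_finrank_eq_one {K E : Type*} [CommRing K] (hK : IsField K)
    [AddCommGroup E] [Module K E] (h : Module.finrank K E = 1) :
    ∃ v : E, v ≠ 0 ∧ ∀ w, ∃ c : K, c • v = w := by
  let _ := hK.toField
  exact finrank_eq_one_iff'.1 h

lemma IsAffineOpen.isFractionRing_stalk {V : Y.Opens} (hV : IsAffineOpen V) [IsDomain Γ(Y, V)]
    {η : Y} (hηV : η ∈ V) (hη : ∀ f : Γ(Y, V), f ≠ 0 → η ∈ Y.basicOpen f) :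
    @IsFractionRing Γ(Y, V) _ (Y.presheaf.stalk η) _ (Y.presheaf.germ V η hηV).hom.toAlgebra := by
  have h1 := hV.isLocalization_stalk ⟨η, hηV⟩
  have h2 : (hV.primeIdealOf ⟨η, hηV⟩).asIdeal.primeCompl = nonZeroDivisors Γ(Y, V) := by
    ext f
    rw [mem_nonZeroDivisors_iff_ne_zero, Ideal.mem_primeCompl_iff, ← hV.mem_basicOpen_iff]
    exact ⟨IsAffineOpen.ne_zero_of_mem, hη f⟩
  rw [IsLocalization.AtPrime, h2] at h1
  exact h1

namespace Scheme.Modules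

/-! ### Rank-one reflexive sheaves are invertible in codimension one -/

variable {M : Y.Modules} {V : Y.Opens}

lemma isGen_of_locally {g : Γ(M, V)}
    (inj : ∀ W (h : W ≤ V) (a : Γ(Y, W)), a • mres M h g = 0 → ∀ x ∈ W, ∃ W', ∃ i : W' ≤ W,
      x ∈ W' ∧ ores i a = 0)
    (surj : ∀ W (h : W ≤ V) (s : Γ(M, W)), ∀ x ∈ W, ∃ W', ∃ i : W' ≤ W, x ∈ W' ∧
      ∃ a : Γ(Y, W'), a • mres M (i.trans h) g = mres M i s) : IsGen M.val V g :=
  bijective_of_locally (A := (unitM Y).presheaf) (B := M.presheaf) (unitM Y).isSheaf M.isSheaf V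
    (fun W h ↦ AddMonoidHom.mk' (fun a : Γ(Y, W) ↦ (a • mres M h g : Γ(M, W)))
      fun (a b : Γ(Y, W)) ↦ add_smul a b _)
    (fun W h W' i (a : Γ(Y, W)) ↦ by
      refine Eq.trans ?_ (mres_smul M i a (mres M h g)).symm
      exact congrArg (fun s : Γ(M, W') ↦ (ores i a : Γ(Y, W')) • s) (mres_mres M h i g).symm)
    inj surj

/-- The stalk at the generic point is the fraction field and the stalk of `M` is a line over it.
Clearing denominators makes a basis vector come from a section `n₀` over `V`. A proportionality of
germs holds on some basic open, hence on `V` up to a power of a nonzero function, which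
torsion-freeness cancels. -/
lemma exists_germ_smul_eq (hV : IsAffineOpen V) [IsDomain Γ(Y, V)] (hM : IsLocalizingOn M V)
    [Module.IsTorsionFree Γ(Y, V) Γ(M, V)] (hr : HasRankOne M) :
    ∃ n₀ : Γ(M, V), n₀ ≠ 0 ∧ ∀ n : Γ(M, V), ∃ a b : Γ(Y, V), (a ≠ 0 ∨ b ≠ 0) ∧ a • n = b • n₀ := by
  obtain ⟨η, -, hη⟩ := hV.exists_generic
  have hηV := Y.basicOpen_le 1 (hη 1 one_ne_zero)
  let _ : Algebra Γ(Y, V) (Y.presheaf.stalk η) := (Y.presheaf.germ V η hηV).hom.toAlgebra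
  have hfrac : IsFractionRing Γ(Y, V) (Y.presheaf.stalk η) := hV.isFractionRing_stalk hηV hη
  have hK : IsField (Y.presheaf.stalk η) := (IsFractionRing.toField Γ(Y, V)).toIsField
  have hsmul (W : Y.Opens) (hW : η ∈ W) (a : Γ(Y, W)) (s : Γ(M, W)) :
      M.presheaf.germ W η hW (a • s) = Y.presheaf.germ W η hW a • M.presheaf.germ W η hW s :=
    PresheafOfModules.germ_smul (R := Y.presheaf) M.val η W hW a s
  obtain ⟨v, hv, hspan⟩ := hK.exists_smul_eq_of_finrank_eq_one (hr η hK)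
  obtain ⟨W, hW, hηW, s, rfl⟩ := TopCat.Presheaf.exists_le_germ_eq M.presheaf v hηV
  obtain ⟨h, hh, hηh⟩ := hV.exists_mem_basicOpen_le hηV hηW
  obtain ⟨k, t, ht⟩ := hM.exists_extension h (mres M hh s)
  obtain ⟨u, hu⟩ := ((IsAffineOpen.isUnit_ores h (Y.basicOpen_le h) le_rfl).pow k).map
    (Y.presheaf.germ (Y.basicOpen h) η hηh).hom
  have ht' : M.presheaf.germ V η hηV t = u • M.presheaf.germ W η hηW s := by
    rw [← TopCat.Presheaf.germ_res_apply M.presheaf (homOfLE (Y.basicOpen_le h)) η hηh t]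
    refine (congrArg _ ht).trans ((hsmul _ hηh _ _).trans ?_)
    rw [Units.smul_def, hu]
    exact congrArg (Y.presheaf.germ (Y.basicOpen h) η hηh (ores (Y.basicOpen_le h) h ^ k) • ·)
      (TopCat.Presheaf.germ_res_apply M.presheaf (homOfLE hh) η hηh s)
  refine ⟨t, fun h0 ↦ hv ?_, fun n ↦ ?_⟩
  · rw [h0, map_zero, eq_comm, smul_eq_zero_iff_eq] at ht'
    exact ht'
  · obtain ⟨γ, hγ⟩ := hspan (M.presheaf.germ V η hηV n)
    obtain ⟨⟨a, b⟩, hab⟩ := IsLocalization.surj (nonZeroDivisors Γ(Y, V)) (γ * ↑u⁻¹)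
    have hb := nonZeroDivisors.ne_zero b.2
    have hab' : Y.presheaf.germ V η hηV b * γ = Y.presheaf.germ V η hηV a * u := by
      refine Eq.trans ?_ (congrArg (· * (u : Y.presheaf.stalk η)) hab)
      change _ = γ * ↑u⁻¹ * Y.presheaf.germ V η hηV b * u
      rw [mul_right_comm, Units.inv_mul_cancel_right, mul_comm]
    refine ⟨b, a, Or.inl hb, sub_eq_zero.1 ?_⟩
    obtain ⟨W', hηW', i, i', h0⟩ := TopCat.Presheaf.germ_eq M.presheaf η hηV hηV
      ((b : Γ(Y, V)) • n) (a • t) (by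
        rw [hsmul, hsmul, ht', ← hγ, Units.smul_def, ← mul_smul, ← mul_smul, hab'])
    obtain ⟨f, hf, hηf⟩ := hV.exists_mem_basicOpen_le hηV hηW'
    obtain ⟨l, hl⟩ := hM.exists_pow_smul_eq_zero f ((b : Γ(Y, V)) • n - a • t) (by
      have h1 : mres M i.le ((b : Γ(Y, V)) • n) = mres M i.le (a • t) := h0
      rw [map_sub, ← mres_mres M i.le hf, h1, mres_mres, sub_self])
    exact (smul_eq_zero_iff_right (pow_ne_zero l (IsAffineOpen.ne_zero_of_mem hηf))).1 hl

/-- On a Krull chart the module of sections is isomorphic, through `φ`, to a nonzero ideal. A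
generator of that ideal over `D(f)` gives a generator of `M` over `D(f)`, because sections of `M`
over basic opens are fractions of sections over the chart. -/
lemma hasGenAt_of_isRankOneReflexive (hY : Y.IsLocallyKrull) (hM : IsRankOneReflexive M) {x : Y}
    (hx : Order.coheight x ≤ 1) : HasGenAt M x := by
  obtain ⟨V, hxV, hV, hA⟩ := hY x
  have := hA.isDomain
  have hQ := isLocalizingOn_of_isQuasicoherent hV hM.1.1.1
  have hL := hM.1.1.2 V hV inferInstance
  have := hL.1
  obtain ⟨n₀, hn₀, hdep⟩ := exists_germ_smul_eq hV hQ hM.2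
  obtain ⟨φ, hφ⟩ := hL.exists_injective hn₀ hdep
  have hI : LinearMap.range φ ≠ ⊥ := fun h ↦ hn₀ (hφ (by
    rw [map_zero, ← Ideal.mem_bot (R := Γ(Y, V)), ← h]; exact ⟨n₀, rfl⟩))
  obtain ⟨_, ⟨g, rfl⟩, hg, f, hf, m, hfm⟩ := hA.exists_generator
    (p := (hV.primeIdealOf ⟨x, hxV⟩).asIdeal) ((hV.height_primeIdealOf _).trans_le hx) hI
  refine ⟨Y.basicOpen f, (hV.mem_basicOpen_iff ⟨x, hxV⟩ f).2 hf, mres M (Y.basicOpen_le f) g,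
    isGen_of_locally (fun W hW a ha y hy ↦ ?_) fun W hW s y hy ↦ ?_⟩
  · obtain ⟨h, hh, hyh⟩ := hV.exists_mem_basicOpen_le (Y.basicOpen_le f (hW hy)) hy
    refine ⟨_, hh, hyh, ?_⟩
    obtain ⟨k, c, hc⟩ := hV.exists_pow_mul_eq h (Y.basicOpen_le h) rfl (ores hh a)
    have hu := (IsAffineOpen.isUnit_ores h (Y.basicOpen_le h) le_rfl).pow k
    have h0 : mres M (Y.basicOpen_le h) (c • g) = 0 := by
      have := congrArg (mres M hh) ha
      rw [mres_smul, mres_mres, mres_mres, map_zero] at this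
      rw [mres_smul, hc, mul_smul, this, smul_zero]
    obtain ⟨l, hl⟩ := hQ.exists_pow_smul_eq_zero h _ h0
    have hl' := congrArg φ hl
    rw [φ.map_smul, φ.map_smul, φ.map_zero, smul_eq_mul, smul_eq_mul] at hl'
    have hc0 : c = 0 := ((mul_eq_zero.1 hl').resolve_left
      (pow_ne_zero l (IsAffineOpen.ne_zero_of_mem hyh)) |> mul_eq_zero.1).resolve_right hg
    rw [hc0, map_zero, eq_comm, hu.mul_right_eq_zero] at hc
    exact hc
  · obtain ⟨h, hh, hyh⟩ := hV.exists_mem_basicOpen_le (Y.basicOpen_le f (hW hy)) hy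
    obtain ⟨k, t, ht⟩ := hQ.exists_extension h (mres M hh s)
    obtain ⟨c, hc⟩ := hfm (φ t) ⟨t, rfl⟩
    have hc' : f ^ m • t = c • g := hφ (by
      rw [φ.map_smul, φ.map_smul, smul_eq_mul, smul_eq_mul, hc, mul_comm])
    have hu := ((IsAffineOpen.isUnit_ores f (Y.basicOpen_le h) (hh.trans hW)).pow m).mul
      ((IsAffineOpen.isUnit_ores h (Y.basicOpen_le h) le_rfl).pow k)
    obtain ⟨u, hu⟩ := hu
    -- From `f ^ m • t = c • g` and `t = h ^ k • s` on `D(h)`, the coefficient of `s` is `c / (f ^ m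
    -- * h ^ k)`, whose denominator `u` is a unit there.
    refine ⟨_, hh, hyh, (↑u⁻¹ : Γ(Y, Y.basicOpen h)) * ores (Y.basicOpen_le h) c, ?_⟩
    have h1 := congrArg (mres M (Y.basicOpen_le h)) hc'
    rw [mres_smul, mres_smul, ht, map_pow, ← mul_smul, ← hu] at h1
    rw [mres_mres, mul_smul, ← h1, ← mul_smul, Units.inv_mul, one_smul]

end Scheme.Modules

end AlgebraicGeometry

namespace AlgebraicGeometry.Scheme

open Modules

variable {Y : Scheme.{u}}

/-! ### Restriction of rank-one reflexive sheaves to big open subsets -/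

lemma two_le_codim_iff {U : Y.Opens} :
    2 ≤ codim (U : Set Y)ᶜ ↔ ∀ z ∉ U, 2 ≤ Order.coheight z := by
  simp [codim]

lemma BigOpens.mem {U : BigOpens Y} {x : Y} (hx : Order.coheight x ≤ 1) : x ∈ U.1 := by
  by_contra h
  exact absurd ((two_le_codim_iff.1 U.2 x h).trans hx) (by decide)

namespace Modules

/-- Restricting to an open subset in two steps. -/
def restrictRestrictIso (M : Y.Modules) {U V : Y.Opens} (h : V ≤ U) :
    (M.restrict U.ι).restrict (Y.homOfLE h) ≅ M.restrict V.ι :=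
  ((restrictFunctorComp (Y.homOfLE h) U.ι).app M).symm ≪≫
    (restrictFunctorCongr (Y.homOfLE_ι h)).app M

/-- Only generators near the image of `f` are needed, so this also applies to sheaves that are
invertible only on a big open subset. -/
lemma nonempty_restrict_tensor_iso {X : Scheme.{u}} (f : X ⟶ Y) [IsOpenImmersion f]
    {L M : Y.Modules} (hL : ∀ x, HasGenAt L (f x)) (hM : ∀ x, HasGenAt M (f x)) :
    Nonempty ((tensor L M).restrict f ≅ tensor (L.restrict f) (M.restrict f)) := by
  have : IsIso (shfLift (resTensorP f L M)) := by
    refine isIso_shfLift _ fun x ↦ ?_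
    obtain ⟨V, hV, g, hg⟩ := hL x
    obtain ⟨W, hW, g', hg'⟩ := hM x
    have h1 := f.image_preimage_le (V ⊓ W)
    refine ⟨f ⁻¹ᵁ (V ⊓ W), ⟨hV, hW⟩, _, gen_tensor (hg.restrict f (h1.trans inf_le_left))
      (hg'.restrict f (h1.trans inf_le_right)), ?_⟩
    have h2 := gen_tensor (hg.res (h1.trans inf_le_left)) (hg'.res (h1.trans inf_le_right))
    have h3 := (toShf_gen h2).restrict (L := tensor L M) f (W := f ⁻¹ᵁ (V ⊓ W)) le_rfl
    exact Eq.mp (congrArg (IsGen _ _) (mres_self (tensor L M) _)) h3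
  exact ⟨(@asIso X.Modules _ _ _ _ this).symm⟩

lemma nonempty_restrict_bidual_iso {X : Scheme.{u}} (f : X ⟶ Y) [IsOpenImmersion f]
    {M : Y.Modules} (hM : ∀ x, HasGenAt M (f x)) :
    Nonempty (M.restrict f ≅ (dual (dual M)).restrict f) := by
  have : IsIso ((restrictFunctor f).map (toBidual M)) := isIso_restrict_of_gen f _ fun x ↦ by
    obtain ⟨V, hV, g, hg⟩ := hM x
    exact ⟨V, hV, g, hg, hg.bidual⟩
  exact ⟨asIso ((restrictFunctor f).map (toBidual M))⟩

section

variable {X : Scheme.{u}} (f : X ⟶ Y) [IsOpenImmersion f]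

lemma ExtendsInCodimTwo.restrict {M : Y.Modules} (hM : ExtendsInCodimTwo M) :
    ExtendsInCodimTwo (M.restrict f) := fun V W h hz ↦ by
  refine hM (f ''ᵁ V) (f ''ᵁ W) (f.image_mono h) ?_
  rintro _ ⟨z, hzV, rfl⟩ hzW
  exact (hz z hzV fun h' ↦ hzW ⟨z, h', rfl⟩).trans_eq (coheight_eq_of_isOpenImmersion f).symm

lemma ExtendsInCodimTwo.pushforward {L : X.Modules} (hL : ExtendsInCodimTwo L) :
    ExtendsInCodimTwo ((pushforward f).obj L) := fun V W h hz ↦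
  hL (f ⁻¹ᵁ V) (f ⁻¹ᵁ W) (f.preimage_mono h) fun z hzV hzW ↦ by
    rw [← coheight_eq_of_isOpenImmersion f]
    exact hz (f z) hzV hzW

/-- An invertible sheaf is isomorphic to its bidual, and duals extend sections. -/
lemma IsInvertible.extendsInCodimTwo {L : X.Modules} (hL : IsInvertible L)
    (hX : ExtendsInCodimTwo (unitM X)) : ExtendsInCodimTwo L := by
  have : IsIso (toBidual L) := isIso_of_gen _ fun x ↦ by
    obtain ⟨V, hV, g, hg⟩ := hL x
    exact ⟨V, hV, g, hg, IsGen.bidual hg⟩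
  exact (extendsInCodimTwo_dual hX (Modules.dual L)).of_iso (asIso (toBidual L)).symm

lemma HasGenAt.of_iso {M N : Y.Modules} (e : M ≅ N) {x : Y} (h : HasGenAt M x) :
    HasGenAt N x := by
  obtain ⟨V, hV, g, hg⟩ := h
  refine ⟨V, hV, e.hom.app V g, fun W hW ↦ ?_⟩
  have key : (fun a : Γ(Y, W) ↦ (a • mres N hW (e.hom.app V g) : Γ(N, W))) =
      e.hom.app W ∘ fun a : Γ(Y, W) ↦ (a • mres M hW g : Γ(M, W)) := funext fun a ↦ by
    refine Eq.trans ?_ ((e.hom.val.app (op W)).hom.map_smul a (mres M hW g)).symm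
    exact congrArg (fun s : Γ(N, W) ↦ a • s) (mres_app e.hom hW g).symm
  exact Eq.mpr (congrArg Function.Bijective key)
    ((ConcreteCategory.bijective_of_isIso (e.hom.app W)).comp (hg W hW))

lemma hasGenAt_pushforward {L : X.Modules} (hL : IsInvertible L) (x : X) :
    HasGenAt ((pushforward f).obj L) (f x) :=
  hasGenAt_of_restrict f <|
    HasGenAt.of_iso (asIso ((restrictAdjunction f).counit.app L)).symm (hL x)

end

variable (hY : Y.IsLocallyKrull)

include hY

lemma IsRankOneReflexive.extendsInCodimTwo {M : Y.Modules} (hM : IsRankOneReflexive M) :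
    ExtendsInCodimTwo M :=
  have := hM.1.2
  (extendsInCodimTwo_dual hY.extendsInCodimTwo_unit (dual M)).of_iso (asIso (toBidual M)).symm

lemma IsRankOneReflexive.bidual_tensor {M N : Y.Modules} (hM : IsRankOneReflexive M)
    (hN : IsRankOneReflexive N) : IsRankOneReflexive (dual (dual (tensor M N))) :=
  isRankOneReflexive_of_extendsInCodimTwo hY (extendsInCodimTwo_dual hY.extendsInCodimTwo_unit _)
    fun _ hx ↦ ((hasGenAt_of_isRankOneReflexive hY hM hx).tensor
      (hasGenAt_of_isRankOneReflexive hY hN hx)).dual.dual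

/-- Both sheaves are the pushforwards of their restrictions to `U`. This gives injectivity of the
comparison map. -/
lemma nonempty_iso_of_restrict {M N : Y.Modules} (hM : IsRankOneReflexive M)
    (hN : IsRankOneReflexive N) (U : BigOpens Y) (e : M.restrict U.1.ι ≅ N.restrict U.1.ι) :
    Nonempty (M ≅ N) := by
  have hU := two_le_codim_iff.1 U.2
  have h1 := isIso_unit_of_extendsInCodimTwo (hM.extendsInCodimTwo hY) hU
  have h2 := isIso_unit_of_extendsInCodimTwo (hN.extendsInCodimTwo hY) hU
  exact ⟨asIso ((restrictAdjunction U.1.ι).unit.app M) ≪≫ (pushforward U.1.ι).mapIso e ≪≫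
    (asIso ((restrictAdjunction U.1.ι).unit.app N)).symm⟩

/-- A big open subset contains all points of codimension at most one, and the pushforward restricts
back to `L` on it, so the criterion applies. This gives surjectivity of the comparison map. -/
lemma isRankOneReflexive_pushforward (U : BigOpens Y) {L : U.1.toScheme.Modules}
    (hL : IsInvertible L) : IsRankOneReflexive ((pushforward U.1.ι).obj L) :=
  isRankOneReflexive_of_extendsInCodimTwo hY
    ((hL.extendsInCodimTwo ((hY.extendsInCodimTwo_unit.restrict U.1.ι).of_iso
      (restrictUnitIso U.1.ι))).pushforward U.1.ι)
    fun _ hx ↦ hasGenAt_pushforward U.1.ι hL ⟨_, BigOpens.mem hx⟩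

end Modules

/-! ### The comparison of the class group with the limit of the Picard groups -/

/-- Two classes agree in the direct limit exactly when they agree at a later stage, and successive
restrictions of a sheaf on `Y` are identified with the direct one. -/
lemma PicLimit.of_restrict_eq_iff {M N : Y.Modules} {U V : BigOpens Y}
    (hM : IsInvertible (M.restrict U.1.ι)) (hN : IsInvertible (N.restrict V.1.ι)) :
    PicLimit.of U (Pic.mk _ hM) = PicLimit.of V (Pic.mk _ hN) ↔
      ∃ W : BigOpens Y, U ≤ W ∧ V ≤ W ∧ Nonempty (M.restrict W.1.ι ≅ N.restrict W.1.ι) := by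
  refine Quotient.eq.trans ⟨?_, ?_⟩
  · rintro ⟨W, hU, hV, h⟩
    obtain ⟨e⟩ := Pic.mk_eq_mk.1 h
    exact ⟨W, hU, hV, ⟨(restrictRestrictIso M hU).symm ≪≫ e ≪≫ restrictRestrictIso N hV⟩⟩
  · rintro ⟨W, hU, hV, ⟨e⟩⟩
    exact ⟨W, hU, hV, Pic.mk_eq_mk.2
      ⟨restrictRestrictIso M hU ≪≫ e ≪≫ (restrictRestrictIso N hV).symm⟩⟩

/-- The open subset of all points near which a rank-one reflexive sheaf is invertible. -/
def bigGenLocus (hY : Y.IsLocallyKrull) {M : Y.Modules} (hM : IsRankOneReflexive M) : BigOpens Y :=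
  ⟨genLocus M, two_le_codim_iff.2 fun _ hz ↦ by
    by_contra h
    exact hz (hasGenAt_of_isRankOneReflexive hY hM (Order.le_of_lt_succ (not_le.1 h)))⟩

/-- The restriction of a rank-one reflexive sheaf to the big open subsets on which it is
invertible. -/
def Cl.toPicLimit (hY : Y.IsLocallyKrull) : Cl Y → PicLimit Y :=
  Quotient.lift (fun M : {M : Y.Modules // IsRankOneReflexive M} ↦
    PicLimit.of (bigGenLocus hY M.2) (Pic.mk (M.1.restrict (bigGenLocus hY M.2).1.ι)
      (isInvertible_restrict (bigGenLocus hY M.2).1.ι fun y ↦ y.2)))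
    fun M N ⟨e⟩ ↦ by
      obtain ⟨W, hU, hV⟩ := exists_ge_ge (bigGenLocus hY M.2) (bigGenLocus hY N.2)
      exact (PicLimit.of_restrict_eq_iff (U := bigGenLocus hY M.2) (V := bigGenLocus hY N.2) _ _).2
        ⟨W, hU, hV, ⟨(Modules.restrictFunctor W.1.ι).mapIso e⟩⟩

lemma Cl.toPicLimit_mk (hY : Y.IsLocallyKrull) {M : Y.Modules} (hM : IsRankOneReflexive M)
    (U : BigOpens Y) (hL : IsInvertible (M.restrict U.1.ι)) :
    Cl.toPicLimit hY (Cl.mk M hM) = PicLimit.of U (Pic.mk (M.restrict U.1.ι) hL) := by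
  obtain ⟨W, hU, hV⟩ := exists_ge_ge (bigGenLocus hY hM) U
  exact (PicLimit.of_restrict_eq_iff (U := bigGenLocus hY hM) _ _).2 ⟨W, hU, hV, ⟨Iso.refl _⟩⟩

lemma Cl.toPicLimit_bijective (hY : Y.IsLocallyKrull) :
    Function.Bijective (Cl.toPicLimit hY) := by
  constructor
  · rintro ⟨M, hM⟩ ⟨N, hN⟩ h
    obtain ⟨W, -, -, ⟨e⟩⟩ := (PicLimit.of_restrict_eq_iff (U := bigGenLocus hY hM)
      (V := bigGenLocus hY hN) _ _).1 h
    exact Quotient.sound (nonempty_iso_of_restrict hY hM hN W e)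
  · rintro ⟨U, ⟨L, hL⟩⟩
    let e : ((pushforward U.1.ι).obj L).restrict U.1.ι ≅ L :=
      asIso ((restrictAdjunction U.1.ι).counit.app L)
    refine ⟨Cl.mk _ (isRankOneReflexive_pushforward hY U hL), (Cl.toPicLimit_mk hY _ U
      (isInvertible_restrict _ fun y ↦ hasGenAt_pushforward U.1.ι hL y)).trans ?_⟩
    exact congrArg (PicLimit.of U) (Pic.mk_eq_mk.2 ⟨e⟩)

/-- On a big open subset where both sheaves are invertible, the tensor product commutes with
restriction and is already isomorphic to its bidual. -/
lemma Cl.toPicLimit_mk_bidual_tensor (hY : Y.IsLocallyKrull) {M N : Y.Modules}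
    (hM : IsRankOneReflexive M) (hN : IsRankOneReflexive N) :
    Cl.toPicLimit hY (Cl.mk _ (hM.bidual_tensor hY hN)) =
      Cl.toPicLimit hY (Cl.mk M hM) + Cl.toPicLimit hY (Cl.mk N hN) := by
  obtain ⟨W, hU, hV⟩ := exists_ge_ge (bigGenLocus hY hM) (bigGenLocus hY hN)
  have gM (y : W.1) : HasGenAt M (W.1.ι y) := hU y.2
  have gN (y : W.1) : HasGenAt N (W.1.ι y) := hV y.2
  rw [Cl.toPicLimit_mk hY hM W (isInvertible_restrict _ gM),
    Cl.toPicLimit_mk hY hN W (isInvertible_restrict _ gN),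
    Cl.toPicLimit_mk hY _ W (isInvertible_restrict _ fun y ↦ ((gM y).tensor (gN y)).dual.dual),
    ← map_add, Pic.mk_add_mk]
  obtain ⟨e⟩ := nonempty_restrict_bidual_iso W.1.ι fun y ↦ (gM y).tensor (gN y)
  obtain ⟨e'⟩ := nonempty_restrict_tensor_iso W.1.ι gM gN
  exact congrArg (PicLimit.of W) (Pic.mk_eq_mk.2 ⟨e.symm ≪≫ e'⟩)

end AlgebraicGeometry.Scheme

end

open AlgebraicGeometry AlgebraicGeometry.Scheme AlgebraicGeometry.Scheme.Modules in
theorem mainTheorem9 (Y : Scheme.{u}) [CompactSpace Y] (hY : Y.IsLocallyKrull) :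
    ∃ _ : AddCommGroup (Cl Y),
      (∀ (M N : Y.Modules) (hM : IsRankOneReflexive M) (hN : IsRankOneReflexive N),
        ∃ h : IsRankOneReflexive (dual (dual (tensor M N))),
          Cl.mk M hM + Cl.mk N hN = Cl.mk (dual (dual (tensor M N))) h) ∧
      ∃ e : Cl Y ≃+ PicLimit Y,
        ∀ (M : Y.Modules) (hM : IsRankOneReflexive M) (U : BigOpens Y)
          (hL : IsInvertible (M.restrict U.1.ι)),
          e (Cl.mk M hM) = PicLimit.of U (Pic.mk (M.restrict U.1.ι) hL) := by
  let e := Equiv.ofBijective _ (Cl.toPicLimit_bijective hY)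
  -- The group structure is pulled back along the bijection, so the addition formula only has to be
  -- checked in the limit.
  let _ := e.addCommGroup
  refine ⟨inferInstance, fun M N hM hN ↦ ⟨hM.bidual_tensor hY hN, ?_⟩, e.addEquiv,
    fun M hM ↦ Cl.toPicLimit_mk hY hM⟩
  refine e.injective (Eq.trans ?_ (Cl.toPicLimit_mk_bidual_tensor hY hM hN).symm)
  exact map_add e.addEquiv _ _
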